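/- Let $H=(V,E)$ be a finite hypergraph ($E$ may be a multiset of edges), let $a:E\to[0,\infty)$ be an edge-weighting, and let $r\ge 2$ and $\Delta$ be globally known bounds such that $|e|\le r$ for every edge $e$ and every vertex lies in at most $\Delta$ edges. Write $N(v)$ for the set of edges containing $v$, $\deg_L(v)=|N(v)\cap L|$, and $a(L)=\sum_{e\in L}a(e)$ for $L\subseteq E$. With $\log$ the natural logarithm, put $$w=\lceil 2\log_2(r\log_2\Delta)\rceil,\quad s=\Big\lceil\log_2\frac{\Delta}{w^4\log^{10}(r\Delta)}\Big\rceil,\quad \alpha=2^{1/s},\quad x=\Delta 2^{-s},\quad \beta=16r(ex/w)^w,\quad b_i=\frac{2^{-(s-i)(w+1)}\alpha^{s-i}}{\beta},$$ and for $L\subseteq E$ and $0\le i\le s$ define $$S_i(L)=\Big(\frac1{2\alpha}\Big)^{s-i}a(L)-b_i\sum_{v\in V}\Big(\binom{\Delta2^{-i}}{w}+\binom{\deg_L(v)}{w}\Big)a(N(v)\cap L),$$ where $\binom{y}{w}=y(y-1)\cdots(y-w+1)/w!$ for real $y$. The algorithm is a deterministic LOCAL algorithm on the incidence graph $\mathrm{Inc}(H)$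 (the bipartite graph on $V\cup E$ in which $v$ and $e$ are adjacent iff $v\in e$): in each synchronous round every node performs an arbitrary local computation and exchanges messages of arbitrary size with its neighbors. Nodes have arbitrary distinct identifiers. They are also given a good coloring of $H$, that is, a proper vertex coloring of the square of $\mathrm{Inc}(H)$ with at most $K(r\Delta)^K$ colors, for an arbitrary fixed constant $K$. Each edge node also knows its weight and whether it belongs to the current edge set. **Lemma.** For every constant $K$ there is a constant $C$ such that, for all $r\ge2$, all $\Delta$ and every integer $i$ with $0\le i<s$, there is a deterministic LOCAL algorithm with the following properties. It runs for at most $$C\,y\,(1+\log y)^{C},\qquad y=r+\log\Delta,$$ rounds, that is, for $\tilde O(r+\log\Delta)$ rounds, independently of $|V|$ and $|E|$. On every such $H$ with a good coloring and edge-weighting $a$, and for every $E_i\subseteq E$ with $\deg_{E_i}(v)\le\Delta2^{4-i}$ for all $v\in V$, it outputs an edge set $E_{i+1}\subseteq E_i$ with $$S_{i+1}(E_{i+1})\ge S_i(E_i).$$ -/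

import Mathlib

/-- A multi-hypergraph with vertex set `V` and hyperedges labelled by `E`; different labels may
carry the same vertex set, so the edges form a multiset. -/
structure MultiHypergraph (V E : Type*) where
  verts : E → Finset V

namespace MultiHypergraph

/-- `deg_L(v)`: the number of hyperedges of `L` that contain `v`. -/
def degOn {V E : Type*} [DecidableEq V] (H : MultiHypergraph V E) (L : Finset E) (v : V) : ℕ :=
  (L.filter (fun e => v ∈ H.verts e)).card

/-- `a(N(v) ∩ L)`: the total weight of the hyperedges of `L` that contain `v`. -/
def weightOn {V E : Type*} [DecidableEq V] (H : MultiHypergraph V E) (a : E → ℝ)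
    (L : Finset E) (v : V) : ℝ :=
  ∑ e ∈ L.filter (fun e => v ∈ H.verts e), a e

/-- The incidence graph: bipartite between vertices and hyperedges, `v ~ e` iff `v ∈ e`. -/
def incGraph {V E : Type*} (H : MultiHypergraph V E) : SimpleGraph (V ⊕ E) where
  Adj x y := (∃ v e, x = Sum.inl v ∧ y = Sum.inr e ∧ v ∈ H.verts e) ∨
    (∃ v e, x = Sum.inr e ∧ y = Sum.inl v ∧ v ∈ H.verts e)
  symm := ⟨by
    rintro x y (⟨v, e, hx, hy, h⟩ | ⟨v, e, hx, hy, h⟩)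
    · exact Or.inr ⟨v, e, hy, hx, h⟩
    · exact Or.inl ⟨v, e, hy, hx, h⟩⟩
  loopless := ⟨by
    rintro x (⟨v, e, hx, hy, h⟩ | ⟨v, e, hx, hy, h⟩)
    · rw [hx] at hy; cases hy
    · rw [hx] at hy; cases hy⟩

end MultiHypergraph

/-- The power graph `G^t`: distinct nodes joined by a walk of length at most `t` in `G`. -/
def powerGraph {N : Type*} (G : SimpleGraph N) (t : ℕ) : SimpleGraph N where
  Adj x y := x ≠ y ∧ ∃ p : G.Walk x y, p.length ≤ t
  symm := ⟨by
    rintro x y ⟨hne, p, hp⟩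
    exact ⟨hne.symm, p.reverse, by simpa using hp⟩⟩
  loopless := ⟨fun _ h => h.1 rfl⟩

/-- A good coloring: a proper vertex coloring of the square of the incidence graph whose palette
has at most `K (r Δ)^K` colors, that is, polynomially many in the rank and the maximum degree. -/
def IsGoodColoring {V E : Type*} (H : MultiHypergraph V E) (K r Δ : ℕ) (c : V ⊕ E → ℕ) : Prop :=
  (∀ x y, (powerGraph H.incGraph 2).Adj x y → c x ≠ c y) ∧ ∀ x, c x < K * (r * Δ) ^ K

/-- A deterministic algorithm in the LOCAL model, with arbitrary local computations and messages of
arbitrary size. A node starts from its identifier, the identifiers of its neighbors and its local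
input. In a round it sends to each neighbor a message, which may depend on the identifier of that
neighbor, and updates its state from the received pairs (identifier of the sender, message). -/
structure LocalAlgorithm (I O : Type) where
  State : Type
  Msg : Type
  init : ℕ → Set ℕ → I → State
  send : State → ℕ → Msg
  step : State → Set (ℕ × Msg) → State
  output : State → O

namespace LocalAlgorithm

/-- The state of each node after `t` synchronous rounds on the graph `G`, where `ident` assigns the
identifiers and `input` the local inputs. -/
def run {I O : Type} (A : LocalAlgorithm I O) {N : Type*} (G : SimpleGraph N) (ident : N → ℕ)
    (input : N → I) : ℕ → N → A.State
  | 0, x => A.init (ident x) {j | ∃ y, G.Adj x y ∧ ident y = j} (input x)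
  | t + 1, x => A.step (A.run G ident input t x)
      {p | ∃ y, G.Adj x y ∧ p = (ident y, A.send (A.run G ident input t y) (ident x))}

/-- The outputs of the nodes after exactly `T` rounds. -/
def result {I O : Type} (A : LocalAlgorithm I O) {N : Type*} (G : SimpleGraph N) (ident : N → ℕ)
    (input : N → I) (T : ℕ) (x : N) : O :=
  A.output (A.run G ident input T x)

end LocalAlgorithm

/-- The local input of a node of the incidence graph. A vertex knows its color; a hyperedge knows
its color, its weight, and whether it belongs to the current edge set. -/
inductive NodeInput where
  | vertex (color : ℕ) : NodeInput
  | edge (color : ℕ) (weight : ℝ) (active : Bool) : NodeInput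

/-- The local inputs that encode the coloring `c`, the weighting `a` and the edge set `L`. -/
def nodeInput {V E : Type*} [DecidableEq E] (c : V ⊕ E → ℕ) (a : E → ℝ) (L : Finset E) :
    V ⊕ E → NodeInput
  | Sum.inl v => NodeInput.vertex (c (Sum.inl v))
  | Sum.inr e => NodeInput.edge (c (Sum.inr e)) (a e) (decide (e ∈ L))

/-- The set of the hyperedges whose nodes output `true` after `T` rounds of the algorithm `A`, run
on the incidence graph of `H`. -/
def selectedEdges {V E : Type*} [Fintype E] [DecidableEq E] (A : LocalAlgorithm NodeInput Bool)
    (H : MultiHypergraph V E) (ident : V ⊕ E → ℕ) (c : V ⊕ E → ℕ) (a : E → ℝ) (L : Finset E)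
    (T : ℕ) : Finset E :=
  Finset.univ.filter
    (fun e => A.result H.incGraph ident (nodeInput c a L) T (Sum.inr e) = true)

noncomputable section

namespace Rounding

/-- `w = ⌈2 log₂ (r log₂ Δ)⌉`. -/
def w (r Δ : ℕ) : ℕ := ⌈2 * Real.logb 2 ((r : ℝ) * Real.logb 2 (Δ : ℝ))⌉₊

/-- The number of stages `s = ⌈log₂ (Δ / (w⁴ log¹⁰ (r Δ)))⌉`, possibly not positive. -/
def s (r Δ : ℕ) : ℤ :=
  ⌈Real.logb 2 ((Δ : ℝ) / ((w r Δ : ℝ) ^ 4 * Real.log ((r : ℝ) * (Δ : ℝ)) ^ 10))⌉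

/-- `α = 2^{1/s}`. -/
def α (r Δ : ℕ) : ℝ := (2 : ℝ) ^ (1 / (s r Δ : ℝ))

/-- `x = Δ 2^{-s}`. -/
def x (r Δ : ℕ) : ℝ := (Δ : ℝ) * (2 : ℝ) ^ (-(s r Δ))

/-- `β = 16 r (e x / w)^w`. -/
def β (r Δ : ℕ) : ℝ := 16 * (r : ℝ) * (Real.exp 1 * x r Δ / (w r Δ : ℝ)) ^ (w r Δ)

/-- `b_i = 2^{-(s-i)(w+1)} α^{s-i} / β`. -/
def b (r Δ i : ℕ) : ℝ :=
  (2 : ℝ) ^ (-((s r Δ - (i : ℤ)) * ((w r Δ : ℤ) + 1))) * α r Δ ^ (s r Δ - (i : ℤ)) / β r Δ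

/-- The potential
`S_i = (1/(2α))^{s-i} a(L) - b_i ∑_v (binom(Δ 2^{-i}, w) + binom(deg_L(v), w)) a(N(v) ∩ L)`
of the edge set `L` at stage `i`; the first binomial coefficient has a real upper argument. -/
def S {V E : Type*} [Fintype V] [DecidableEq V] (H : MultiHypergraph V E) (a : E → ℝ)
    (r Δ i : ℕ) (L : Finset E) : ℝ :=
  (1 / (2 * α r Δ)) ^ (s r Δ - (i : ℤ)) * ∑ e ∈ L, a e
    - b r Δ i * ∑ v : V,
        (Ring.choose ((Δ : ℝ) * (2 : ℝ) ^ (-(i : ℤ))) (w r Δ)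
          + ((H.degOn L v).choose (w r Δ) : ℝ)) * H.weightOn a L v

end Rounding

end

set_option linter.unusedSectionVars false

/-! Call (e, W) a pair at v if e is a hyperedge at v and W is a w-subset of the hyperedges at v. The
penalty binom(deg, w) · a(N(v)) is the total weight of these pairs. Keeping every hyperedge with
probability 1/2 would halve a(L) and keep a pair with e ∉ W with probability 2^{-(w+1)}. The ratio
b_{i+1} / b_i is made for exactly this, and the factors α leave some slack. The proof derandomises
the sampling and spreads the halving over w + 1 steps of survival probability p, where p^{w+1} =
1/2.

In one step, conditional expectations are followed color class by color class. The given proper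
coloring has too many classes for this, so a defective coloring with q² colors replaces it. The
estimator `poly` keeps only one variable per color in the survival probability of a pair. It is
therefore affine in each color class, so that a whole class can decide at once by the signs of
`edgeGain` (`objective_sub_objective`), and it still bounds what survives (`le_poly_of_zero_one`).
Dropped variables cost little because p is close to 1: losing j of w + 1 factors costs at most a
factor 1 + j/(w+1) (`pow_le_pow_mul_one_add`). The number j is at most the number of ordered
monochromatic couples inside W ∪ {e}, plus one if e ∈ W.

The monochromatic couples are made rare by the choice of the coloring: two Reed–Solomon color
reductions and a greedy choice among q values leave a fraction 3/q of them (`runRules_refineRules`),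
and doing this twice leaves 9/q². The pairs with e ∈ W are negligible against binom(deg, w) if the
degree is large, and against binom(Δ2^{-i}, w) if it is small (`choose_pred_small`). A step thus
loses a factor 1 + η with η = 1/(2s(w+1)), and (1 + η)^{w+1} ≤ α. It suffices that q² is of order
w²s, and the number of rounds is q² up to factors polylogarithmic in r + log Δ
(`exists_parameters`). -/

open Classical in
/-- A finite set as a `Finset`; infinite sets are sent to `∅`. -/
noncomputable def Set.asFinset {β : Type*} (S : Set β) : Finset β :=
  if h : S.Finite then h.toFinset else ∅

theorem Set.asFinset_eq {β : Type*} {S : Set β} {F : Finset β} (h : ∀ x, x ∈ S ↔ x ∈ F) :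
    S.asFinset = F := by
  have hS : S = ↑F := by ext x; simpa using h x
  subst hS
  simp [Set.asFinset]

/-! ### Adjacency in the incidence graph. -/

namespace MultiHypergraph

/-- The hyperedges that contain `v`. -/
def edgesAt {V E : Type*} [Fintype E] [DecidableEq V] (H : MultiHypergraph V E) (v : V) :
    Finset E :=
  Finset.univ.filter (fun e => v ∈ H.verts e)

theorem mem_edgesAt {V E : Type*} [Fintype E] [DecidableEq V] (H : MultiHypergraph V E) (v : V)
    (e : E) : e ∈ H.edgesAt v ↔ v ∈ H.verts e := by
  simp [edgesAt]

theorem incGraph_adj_inl_inr {V E : Type*} (H : MultiHypergraph V E) (v : V) (e : E) :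
    H.incGraph.Adj (Sum.inl v) (Sum.inr e) ↔ v ∈ H.verts e := by
  constructor
  · rintro (⟨v', e', hx, hy, h⟩ | ⟨v', e', hx, hy, h⟩)
    · cases hx; cases hy; exact h
    · cases hx
  · intro h; exact Or.inl ⟨v, e, rfl, rfl, h⟩

theorem incGraph_not_adj_inl_inl {V E : Type*} (H : MultiHypergraph V E) (v v' : V) :
    ¬ H.incGraph.Adj (Sum.inl v) (Sum.inl v') := by
  rintro (⟨v', e', hx, hy, h⟩ | ⟨v', e', hx, hy, h⟩)
  · cases hy
  · cases hx

theorem incGraph_not_adj_inr_inr {V E : Type*} (H : MultiHypergraph V E) (e e' : E) :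
    ¬ H.incGraph.Adj (Sum.inr e) (Sum.inr e') := by
  rintro (⟨v', e', hx, hy, h⟩ | ⟨v', e', hx, hy, h⟩)
  · cases hx
  · cases hy

end MultiHypergraph

/-! ### Rules for hyperedges and their simulation in the LOCAL model. -/

namespace LocalRounding

/-- A rule by which a hyperedge updates its label from its own label and, for each of its
vertices, the identifier of the vertex and the labels of the hyperedges that contain it. -/
abbrev Rule (X : Type) : Type := X → Finset (ℕ × Finset X) → X

section Rules

variable {X : Type} {V E : Type*} [Fintype E] [DecidableEq V]

open Classical in
/-- What a hyperedge sees of its neighborhood: the identifier of each of its vertices with the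
labels of the hyperedges that contain the vertex. -/
noncomputable def view (H : MultiHypergraph V E) (ident : V ⊕ E → ℕ) (l : E → X) (e : E) :
    Finset (ℕ × Finset X) :=
  (H.verts e).image (fun v => (ident (Sum.inl v), (H.edgesAt v).image l))

/-- The labels after all hyperedges have applied the rule `G` once. -/
noncomputable def applyRule (H : MultiHypergraph V E) (ident : V ⊕ E → ℕ) (G : Rule X)
    (l : E → X) : E → X :=
  fun e => G (l e) (view H ident l e)

/-- The labels after the rules of a list have been applied one after the other. -/
noncomputable def runRules (H : MultiHypergraph V E) (ident : V ⊕ E → ℕ) (Gs : List (Rule X))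
    (l : E → X) : E → X :=
  Gs.foldl (fun l G => applyRule H ident G l) l

theorem runRules_nil (H : MultiHypergraph V E) (ident : V ⊕ E → ℕ) (l : E → X) :
    runRules H ident [] l = l := rfl

theorem runRules_cons (H : MultiHypergraph V E) (ident : V ⊕ E → ℕ) (G : Rule X)
    (Gs : List (Rule X)) (l : E → X) :
    runRules H ident (G :: Gs) l = runRules H ident Gs (applyRule H ident G l) := rfl

theorem runRules_append (H : MultiHypergraph V E) (ident : V ⊕ E → ℕ)
    (Gs Gs' : List (Rule X)) (l : E → X) :
    runRules H ident (Gs ++ Gs') l = runRules H ident Gs' (runRules H ident Gs l) := by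
  simp [runRules, List.foldl_append]

theorem runRules_map_range_succ (H : MultiHypergraph V E) (ident : V ⊕ E → ℕ)
    (G : ℕ → Rule X) (n : ℕ) (l : E → X) :
    runRules H ident ((List.range (n + 1)).map G) l
      = applyRule H ident (G n) (runRules H ident ((List.range n).map G) l) := by
  rw [List.range_succ, List.map_append, runRules_append]
  rfl

theorem runRules_flatMap_range_succ (H : MultiHypergraph V E) (ident : V ⊕ E → ℕ)
    (G : ℕ → List (Rule X)) (n : ℕ) (l : E → X) :
    runRules H ident ((List.range (n + 1)).flatMap G) l
      = runRules H ident (G n) (runRules H ident ((List.range n).flatMap G) l) := by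
  rw [List.range_succ, List.flatMap_append, runRules_append]
  simp

end Rules

/-- One round of `ruleAlgorithm`. -/
noncomputable def ruleStep {X : Type} (Gs : List (Rule X)) (st : ℕ × (X ⊕ Finset X))
    (M : Set (ℕ × (X ⊕ Finset X))) : ℕ × (X ⊕ Finset X) :=
  (st.1 + 1, match st.2 with
    | Sum.inr _ => Sum.inr (Set.asFinset {x | ∃ j, (j, Sum.inl x) ∈ M})
    | Sum.inl x =>
      if st.1 % 2 = 1 then
        Sum.inl ((Gs[st.1 / 2]?.getD (fun x _ => x)) x
          (Set.asFinset {p : ℕ × Finset X | (p.1, Sum.inr p.2) ∈ M}))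
      else Sum.inl x)

/-- The algorithm that executes a list of rules, two rounds for each rule: first the vertices
collect the labels of their hyperedges, then the hyperedges apply the rule. A state holds the
number of rounds so far, and the label of a hyperedge or the collection of a vertex. -/
noncomputable def ruleAlgorithm {X : Type} (start : ℕ → NodeInput → X) (Gs : List (Rule X))
    (out : X → Bool) : LocalAlgorithm NodeInput Bool where
  State := ℕ × (X ⊕ Finset X)
  Msg := X ⊕ Finset X
  init id _ inp := (0, match inp with
    | NodeInput.vertex _ => Sum.inr ∅
    | NodeInput.edge k u b => Sum.inl (start id (NodeInput.edge k u b)))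
  send st _ := st.2
  step st M := ruleStep Gs st M
  output st := match st.2 with
    | Sum.inl x => out x
    | Sum.inr _ => false

section Simulation

variable {X : Type} {V E : Type*} [Fintype E] [DecidableEq V]

/-- The invariant concerns even times only. What a vertex holds then is stale, but it is overwritten
before a hyperedge reads it, so an unspecified `F` is enough. -/
theorem ruleStep_iterate (Gs : List (Rule X)) (H : MultiHypergraph V E) (ident : V ⊕ E → ℕ)
    (l0 : E → X) (R : ℕ → V ⊕ E → ℕ × (X ⊕ Finset X))
    (hE : ∀ e, R 0 (Sum.inr e) = (0, Sum.inl (l0 e)))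
    (hV : ∀ v, R 0 (Sum.inl v) = (0, Sum.inr ∅))
    (hR : ∀ t x, R (t + 1) x = ruleStep Gs (R t x)
      {p | ∃ y, H.incGraph.Adj x y ∧ p = (ident y, (R t y).2)})
    (n : ℕ) (hn : n ≤ Gs.length) :
    (∀ e, R (2 * n) (Sum.inr e) = (2 * n, Sum.inl (runRules H ident (Gs.take n) l0 e))) ∧
    (∀ v, ∃ F, R (2 * n) (Sum.inl v) = (2 * n, Sum.inr F)) := by
  classical
  induction n with
  | zero => exact ⟨hE, fun v => ⟨∅, hV v⟩⟩
  | succ n ih =>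
    obtain ⟨ihE, ihV⟩ := ih (by omega)
    set l := runRules H ident (Gs.take n) l0 with hl
    have hE1 : ∀ e, R (2 * n + 1) (Sum.inr e) = (2 * n + 1, Sum.inl (l e)) := by
      intro e
      rw [hR, ihE]
      simp [ruleStep]
    have hV1 : ∀ v, R (2 * n + 1) (Sum.inl v)
        = (2 * n + 1, Sum.inr ((H.edgesAt v).image l)) := by
      intro v
      obtain ⟨F, hF⟩ := ihV v
      rw [hR, hF]
      simp only [ruleStep]
      congr 2
      apply Set.asFinset_eq
      intro x
      simp only [Set.mem_ofPred_eq, Finset.mem_image, MultiHypergraph.mem_edgesAt]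
      constructor
      · rintro ⟨j, y, hy, hp⟩
        rcases y with v' | e
        · exact (H.incGraph_not_adj_inl_inl v v' hy).elim
        · rw [ihE] at hp
          simp only [Prod.mk.injEq, Sum.inl.injEq] at hp
          exact ⟨e, (H.incGraph_adj_inl_inr v e).1 hy, hp.2.symm⟩
      · rintro ⟨e, he, rfl⟩
        exact ⟨ident (Sum.inr e), Sum.inr e, (H.incGraph_adj_inl_inr v e).2 he, by rw [ihE]⟩
    have h2 : 2 * (n + 1) = (2 * n + 1) + 1 := by ring
    rw [h2]
    refine ⟨fun e => ?_, fun v => ?_⟩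
    · have hlt : n < Gs.length := hn
      have htake : Gs.take (n + 1) = Gs.take n ++ [Gs[n]] := by
        rw [List.take_append_getElem]
      rw [htake, runRules_append, ← hl, hR, hE1]
      have hmod : (2 * n + 1) % 2 = 1 := by omega
      have hdiv : (2 * n + 1) / 2 = n := by omega
      simp only [ruleStep]
      rw [if_pos hmod, hdiv]
      simp only [List.getElem?_eq_getElem hlt, Option.getD_some, runRules, List.foldl_cons,
        List.foldl_nil, applyRule]
      refine congrArg (fun F => (2 * n + 1 + 1, Sum.inl (Gs[n] (l e) F))) ?_
      apply Set.asFinset_eq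
      rintro ⟨j, F⟩
      simp only [Set.mem_ofPred_eq, view, Finset.mem_image]
      constructor
      · rintro ⟨y, hy, hp⟩
        rcases y with v | e'
        · rw [hV1] at hp
          simp only [Prod.mk.injEq, Sum.inr.injEq] at hp
          refine ⟨v, (H.incGraph_adj_inl_inr v e).1 hy.symm, ?_⟩
          rw [hp.1, hp.2]
        · exact (H.incGraph_not_adj_inr_inr e e' hy).elim
      · rintro ⟨v, hv, hp⟩
        simp only [Prod.mk.injEq] at hp
        refine ⟨Sum.inl v, ((H.incGraph_adj_inl_inr v e).2 hv).symm, ?_⟩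
        rw [hV1, ← hp.1, ← hp.2]
    · rw [hR, hV1]
      exact ⟨_, rfl⟩

theorem ruleAlgorithm_result [DecidableEq E] (start : ℕ → NodeInput → X) (Gs : List (Rule X))
    (out : X → Bool) (H : MultiHypergraph V E) (ident : V ⊕ E → ℕ) (c : V ⊕ E → ℕ) (a : E → ℝ)
    (L : Finset E) (e : E) :
    (ruleAlgorithm start Gs out).result H.incGraph ident (nodeInput c a L) (2 * Gs.length)
      (Sum.inr e) = out (runRules H ident Gs
        (fun e => start (ident (Sum.inr e)) (nodeInput c a L (Sum.inr e))) e) := by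
  have h := (ruleStep_iterate Gs H ident
    (fun e => start (ident (Sum.inr e)) (nodeInput c a L (Sum.inr e)))
    ((ruleAlgorithm start Gs out).run H.incGraph ident (nodeInput c a L))
    (fun _ => rfl) (fun _ => rfl) (fun _ _ => rfl) Gs.length le_rfl).1 e
  rw [List.take_length] at h
  exact congrArg (ruleAlgorithm start Gs out).output h

end Simulation

end LocalRounding

namespace LocalRounding

open Finset

/-! ### Best choices and Reed–Solomon codes. -/

section Argmin

open Classical in
/-- A point below `n` at which `F` is minimal. -/
noncomputable def argmin (n : ℕ) (F : ℕ → ℝ) : ℕ :=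
  if h : ∃ m, m < n ∧ ∀ k < n, F m ≤ F k then h.choose else 0

theorem argmin_spec {n : ℕ} (hn : 0 < n) (F : ℕ → ℝ) :
    argmin n F < n ∧ ∀ k < n, F (argmin n F) ≤ F k := by
  have h : ∃ m, m < n ∧ ∀ k < n, F m ≤ F k := by
    obtain ⟨m, hm, hmin⟩ := (range n).exists_min_image F ⟨0, mem_range.2 hn⟩
    exact ⟨m, mem_range.1 hm, fun k hk => hmin k (mem_range.2 hk)⟩
  rw [argmin, dif_pos h]
  exact h.choose_spec

theorem mul_argmin_le_sum {n : ℕ} (hn : 0 < n) (F : ℕ → ℝ) :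
    n * F (argmin n F) ≤ ∑ k ∈ range n, F k := by
  have h := card_nsmul_le_sum (range n) F (F (argmin n F))
    (fun k hk => (argmin_spec hn F).2 k (mem_range.1 hk))
  simpa using h

end Argmin

section Codes

/-- Reed–Solomon codes: `M ≤ 2 ^ t` words over an alphabet of `n` letters, `q t < n ≤ 2 q t`, any
two of which agree in at most a `1 / q` fraction of their `n` positions. -/
theorem exists_code (M t q : ℕ) (hM : M ≤ 2 ^ t) (ht : 1 ≤ t) (hq : 1 ≤ q) :
    ∃ n, q * t < n ∧ n ≤ 2 * (q * t) ∧ ∃ φ : ℕ → ℕ → ℕ, (∀ κ k, φ κ k < n) ∧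
      ∀ κ < M, ∀ κ' < M, κ ≠ κ' →
        q * ((range n).filter (fun k => φ κ k = φ κ' k)).card ≤ n := by
  obtain ⟨n, hprime, hlt, hle⟩ := Nat.exists_prime_lt_and_le_two_mul (q * t)
    (Nat.mul_ne_zero (by omega) (by omega))
  have := Fact.mk hprime
  refine ⟨n, hlt, hle, ?_⟩
  have hcard : Fintype.card (Fin M) ≤ Fintype.card (Fin t → ZMod n) := by
    rw [Fintype.card_fin, Fintype.card_fun, ZMod.card, Fintype.card_fin]
    exact hM.trans (Nat.pow_le_pow_left hprime.two_le t)
  obtain ⟨emb⟩ := Function.Embedding.nonempty_of_card_le hcard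
  -- The code word of `κ` is the value table of a polynomial of degree below `t` over the field with
  -- `n` elements. There are n^t ≥ 2^t of these, and distinct ones agree at fewer than `t` points,
  -- while q t < n.
  let P : ℕ → Polynomial (ZMod n) := fun κ =>
    if h : κ < M then ((Polynomial.degreeLTEquiv (ZMod n) t).symm (emb ⟨κ, h⟩)).1 else 0
  have hPdeg : ∀ κ, P κ ∈ Polynomial.degreeLT (ZMod n) t := by
    intro κ
    by_cases h : κ < M
    · simp only [P, dif_pos h]; exact Subtype.coe_prop _
    · simp only [P, dif_neg h]; exact Submodule.zero_mem _
  have hPinj : ∀ κ < M, ∀ κ' < M, P κ = P κ' → κ = κ' := by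
    intro κ hκ κ' hκ' h
    simp only [P, dif_pos hκ, dif_pos hκ'] at h
    have h1 := emb.injective ((Polynomial.degreeLTEquiv (ZMod n) t).symm.injective (Subtype.ext h))
    exact congrArg Fin.val h1
  refine ⟨fun κ k => ((P κ).eval (k : ZMod n)).val, fun κ k => ZMod.val_lt _, ?_⟩
  intro κ hκ κ' hκ' hne
  set D := P κ - P κ' with hD
  have hD0 : D ≠ 0 := fun h => hne (hPinj κ hκ κ' hκ' (sub_eq_zero.1 h))
  have hDdeg : D.natDegree < t := by
    have : D ∈ Polynomial.degreeLT (ZMod n) t := Submodule.sub_mem _ (hPdeg κ) (hPdeg κ')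
    rw [Polynomial.mem_degreeLT] at this
    exact (Polynomial.natDegree_lt_iff_degree_lt hD0).2 this
  have hcount : ((range n).filter (fun k : ℕ => ((P κ).eval (k : ZMod n)).val
      = ((P κ').eval (k : ZMod n)).val)).card ≤ D.roots.toFinset.card := by
    apply card_le_card_of_injOn (fun k : ℕ => (k : ZMod n))
    · intro k hk
      simp only [coe_filter, mem_range, Set.mem_ofPred_eq] at hk
      simp only [mem_coe, Multiset.mem_toFinset]
      rw [Polynomial.mem_roots hD0, Polynomial.IsRoot.def, hD, Polynomial.eval_sub, sub_eq_zero]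
      exact ZMod.val_injective n hk.2
    · intro k hk k' hk' h
      simp only [coe_filter, mem_range, Set.mem_ofPred_eq] at hk hk'
      have := congrArg ZMod.val h
      simpa [ZMod.val_natCast, Nat.mod_eq_of_lt hk.1, Nat.mod_eq_of_lt hk'.1] using this
  have h2 : D.roots.toFinset.card ≤ D.natDegree :=
    (Multiset.toFinset_card_le _).trans (Polynomial.card_roots' D)
  calc q * _ ≤ q * t := Nat.mul_le_mul_left q ((hcount.trans h2).trans hDdeg.le)
    _ ≤ n := hlt.le

end Codes

/-! ### Monochromatic cost under color reduction and greedy refinement. -/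

section Mono

variable {E τ : Type*} [Fintype E] [DecidableEq τ]

/-- The total cost of the ordered pairs on which `κ` takes the same value. -/
def monoCost (c : E → E → ℝ) (κ : E → τ) : ℝ := ∑ f, ∑ g, if κ f = κ g then c f g else 0

/-- If each `f` reads its code word `φ (src f)` at a position `x f` that is at most as bad for `f`
as the average position, then the codes `(x f, φ (src f) (x f))` of equal `chi` collide little. -/
theorem monoCost_code_le (c : E → E → ℝ) (hc : ∀ f g, 0 ≤ c f g) (chi src x : E → ℕ)
    {M n q : ℕ} (hn : 0 < n) (hq : 0 < q) (φ : ℕ → ℕ → ℕ) (hφ : ∀ κ k, φ κ k < n)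
    (hcode : ∀ κ < M, ∀ κ' < M, κ ≠ κ' →
        q * ((range n).filter (fun k => φ κ k = φ κ' k)).card ≤ n)
    (hsrc : ∀ f, src f < M)
    (hx : ∀ f, n * ∑ g, (if chi g = chi f ∧ src g ≠ src f ∧ φ (src g) (x f) = φ (src f) (x f)
        then c f g else 0)
      ≤ ∑ k ∈ range n, ∑ g, (if chi g = chi f ∧ src g ≠ src f ∧ φ (src g) k = φ (src f) k
        then c f g else 0)) :
    monoCost c (fun f => (chi f, x f * n + φ (src f) (x f)))
      ≤ monoCost c (fun f => (chi f, src f)) + 1 / q * monoCost c chi := by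
  have hn' : (0 : ℝ) < n := by exact_mod_cast hn
  have hq' : (0 : ℝ) < q := by exact_mod_cast hq
  -- Summed over all positions, each `g` with a different source collides at most n / q times, so an
  -- average position costs `f` at most a 1 / q fraction.
  have h1 : ∀ f, ∑ g, (if chi g = chi f ∧ src g ≠ src f ∧ φ (src g) (x f) = φ (src f) (x f)
      then c f g else 0) ≤ 1 / q * ∑ g, (if chi f = chi g then c f g else 0) := by
    intro f
    have h2 : ∑ k ∈ range n, ∑ g, (if chi g = chi f ∧ src g ≠ src f ∧ φ (src g) k = φ (src f) k
        then c f g else 0) ≤ n / q * ∑ g, (if chi f = chi g then c f g else 0) := by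
      rw [sum_comm, mul_sum]
      apply sum_le_sum
      intro g _
      by_cases hcg : chi f = chi g
      · by_cases hs : src g = src f
        · simp only [hs, ne_eq, not_true_eq_false, false_and, and_false, if_false, sum_const_zero]
          have := hc f g
          split_ifs
          positivity
        · simp only [hcg, ne_eq, hs, not_false_eq_true, true_and, if_true]
          rw [← sum_filter, sum_const, nsmul_eq_mul]
          apply mul_le_mul_of_nonneg_right _ (hc f g)
          rw [le_div_iff₀ hq', mul_comm]
          exact_mod_cast hcode _ (hsrc g) _ (hsrc f) hs
      · have : ¬ chi g = chi f := fun h => hcg h.symm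
        simp [hcg, this]
    have h3 := (hx f).trans h2
    have h4 : n / q * ∑ g, (if chi f = chi g then c f g else 0)
      = n * (1 / q * ∑ g, (if chi f = chi g then c f g else 0)) := by ring
    rw [h4] at h3
    exact le_of_mul_le_mul_left h3 hn'
  unfold monoCost
  rw [mul_sum, ← sum_add_distrib]
  apply sum_le_sum
  intro f _
  refine le_trans ?_ (add_le_add_right (h1 f) _)
  rw [← sum_add_distrib]
  apply sum_le_sum
  intro g _
  have hcfg := hc f g
  by_cases hpsi : (chi f, x f * n + φ (src f) (x f)) = (chi g, x g * n + φ (src g) (x g))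
  · rw [if_pos hpsi]
    simp only [Prod.mk.injEq] at hpsi
    by_cases hs : src f = src g
    · rw [if_pos (Prod.ext hpsi.1 hs)]
      split_ifs <;> linarith
    · have hmod := congrArg (· % n) hpsi.2
      simp only [Nat.mul_add_mod_self_right, Nat.mod_eq_of_lt (hφ _ _)] at hmod
      have hxx : x f = x g := by
        have := hpsi.2
        rw [hmod] at this
        have h5 : x f * n = x g * n := by omega
        exact Nat.eq_of_mul_eq_mul_right hn h5
      rw [if_pos (c := chi g = chi f ∧ _) ⟨hpsi.1.symm, fun h => hs h.symm, by rw [hmod, hxx]⟩]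
      split_ifs <;> linarith
  · rw [if_neg hpsi]
    split_ifs <;> linarith

/-- If each `f` takes a value `nw f` that is at most as bad as the average one with respect to
the elements of smaller `psi`, then a `1 / q` fraction of the cost remains, next to the cost of the
pairs of equal `psi`. -/
theorem monoCost_greedy_le (c : E → E → ℝ) (hc : ∀ f g, 0 ≤ c f g) (hsymm : ∀ f g, c f g = c g f)
    (chi psi nw : E → ℕ) {q : ℕ} (hq : 0 < q)
    (hx : ∀ f, q * ∑ g, (if chi g = chi f ∧ psi g < psi f ∧ nw g = nw f then c f g else 0)
      ≤ ∑ g, (if chi g = chi f ∧ psi g < psi f then c f g else 0)) :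
    monoCost c (fun f => (chi f, nw f))
      ≤ 1 / q * monoCost c chi + monoCost c (fun f => (chi f, psi f)) := by
  have hq' : (0 : ℝ) < q := by exact_mod_cast hq
  set S : ℝ := ∑ f, ∑ g, (if chi g = chi f ∧ psi g < psi f ∧ nw g = nw f then c f g else 0) with hS
  set T : ℝ := ∑ f, ∑ g, (if chi g = chi f ∧ psi g < psi f then c f g else 0) with hT
  -- By symmetry of the cost, charging each couple to its member of larger `psi` accounts for
  -- exactly half of the ordered couples.
  have hS' : S = ∑ f, ∑ g, (if chi g = chi f ∧ psi f < psi g ∧ nw g = nw f then c f g else 0) := by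
    rw [hS, sum_comm]
    refine sum_congr rfl fun f _ => sum_congr rfl fun g _ => ?_
    rw [hsymm g f]
    refine if_congr ?_ rfl rfl
    constructor <;> rintro ⟨h1, h2, h3⟩ <;> exact ⟨h1.symm, h2, h3.symm⟩
  have hT' : T = ∑ f, ∑ g, (if chi g = chi f ∧ psi f < psi g then c f g else 0) := by
    rw [hT, sum_comm]
    refine sum_congr rfl fun f _ => sum_congr rfl fun g _ => ?_
    rw [hsymm g f]
    refine if_congr ?_ rfl rfl
    constructor <;> rintro ⟨h1, h2⟩ <;> exact ⟨h1.symm, h2⟩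
  have hST : q * S ≤ T := by
    rw [hS, mul_sum]
    exact sum_le_sum fun f _ => hx f
  have hTT : T + T ≤ monoCost c chi := by
    nth_rewrite 2 [hT']
    rw [hT, ← sum_add_distrib, monoCost]
    apply sum_le_sum
    intro f _
    rw [← sum_add_distrib]
    apply sum_le_sum
    intro g _
    have hcfg := hc f g
    by_cases h : chi f = chi g
    · rcases lt_trichotomy (psi f) (psi g) with h1 | h1 | h1
      · simp [h, h1, not_lt.2 h1.le]
      · simp [h, h1, hcfg]
      · simp [h, h1, not_lt.2 h1.le]
    · have : ¬ chi g = chi f := fun h' => h h'.symm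
      simp [h, this]
  have hmain : monoCost c (fun f => (chi f, nw f))
      ≤ (S + S) + monoCost c (fun f => (chi f, psi f)) := by
    nth_rewrite 2 [hS']
    rw [hS, monoCost, monoCost, ← sum_add_distrib, ← sum_add_distrib]
    apply sum_le_sum
    intro f _
    rw [← sum_add_distrib, ← sum_add_distrib]
    apply sum_le_sum
    intro g _
    have hcfg := hc f g
    by_cases h : chi f = chi g
    · by_cases h' : nw f = nw g
      · rcases lt_trichotomy (psi f) (psi g) with h1 | h1 | h1
        · simp [h, h', h1, not_lt.2 h1.le, h1.ne]
        · simp [h, h', h1]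
        · simp [h, h', h1, not_lt.2 h1.le, h1.ne']
      · have : ¬ nw g = nw f := fun h'' => h' h''.symm
        simp only [Prod.mk.injEq, h, h', and_false, if_false, this, add_zero, zero_add]
        split_ifs <;> linarith
    · have : ¬ chi g = chi f := fun h' => h h'.symm
      simp [h, this]
  refine hmain.trans (add_le_add_left ?_ _)
  have : S ≤ 1 / q * T := by
    rw [one_div, ← div_eq_inv_mul, le_div_iff₀ hq', mul_comm]; exact hST
  calc S + S ≤ 1 / q * (T + T) := by linarith
    _ ≤ _ := by gcongr

end Mono

end LocalRounding

namespace LocalRounding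

open Finset

/-! ### Costs of couples of hyperedges at one vertex. -/

section PairCost

variable {β γ : Type*} [DecidableEq β] [DecidableEq γ]

/-- The total weight of the pairs `(e, W)` of an element `e` and a `w`-element subset `W` of `N`
for which `f` and `g` are distinct elements of `W ∪ {e}`. -/
def pairCost (w : ℕ) (N : Finset β) (a : β → ℝ) (f g : β) : ℝ :=
  ∑ e ∈ N, ∑ W ∈ N.powersetCard w, if f ≠ g ∧ f ∈ insert e W ∧ g ∈ insert e W then a e else 0

theorem pairCost_map (w : ℕ) (φ : β ↪ γ) (N : Finset β) (a : γ → ℝ) (f g : β) :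
    pairCost w (N.map φ) a (φ f) (φ g) = pairCost w N (fun e => a (φ e)) f g := by
  simp only [pairCost, powersetCard_map, sum_map]
  refine sum_congr rfl fun e _ => sum_congr rfl fun W _ => ?_
  have h : ∀ f, φ f ∈ insert (φ e) (W.map φ) ↔ f ∈ insert e W := by
    intro f; rw [← map_insert, mem_map']
  refine if_congr ?_ rfl rfl
  simp only [RelEmbedding.coe_toEmbedding, mapEmbedding_apply, h, ne_eq, φ.injective.eq_iff]

theorem pairCost_nonneg (w : ℕ) (N : Finset β) (a : β → ℝ) (ha : ∀ e, 0 ≤ a e) (f g : β) :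
    0 ≤ pairCost w N a f g := by
  refine sum_nonneg fun e _ => sum_nonneg fun W _ => ?_
  split_ifs
  · exact ha e
  · exact le_rfl

theorem pairCost_comm (w : ℕ) (N : Finset β) (a : β → ℝ) (f g : β) :
    pairCost w N a f g = pairCost w N a g f := by
  refine sum_congr rfl fun e _ => sum_congr rfl fun W _ => if_congr ?_ rfl rfl
  rw [ne_comm, and_comm (a := f ∈ _)]

theorem pairCost_eq_zero (w : ℕ) (N : Finset β) (a : β → ℝ) (f g : β)
    (h : f = g ∨ f ∉ N ∨ g ∉ N) : pairCost w N a f g = 0 := by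
  refine sum_eq_zero fun e he => sum_eq_zero fun W hW => if_neg ?_
  have hsub : insert e W ⊆ N := insert_subset he (mem_powersetCard.1 hW).1
  rintro ⟨h1, h2, h3⟩
  rcases h with h | h | h
  · exact h1 h
  · exact h (hsub h2)
  · exact h (hsub h3)

/-- Interchanging the sums turns costs that hyperedges can compute locally into counts of bad
couples inside each `insert e W`, which is what the estimator loses. -/
theorem sum_pairCost_filter [Fintype β] (w : ℕ) (N : Finset β) (a : β → ℝ) (P : β → β → Prop)
    [DecidableRel P] :
    ∑ f, ∑ g, (if P f g then pairCost w N a f g else 0)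
      = ∑ e ∈ N, ∑ W ∈ N.powersetCard w,
          a e * ((insert e W).offDiag.filter (fun z => P z.1 z.2)).card := by
  have h1 : ∀ f g, (if P f g then pairCost w N a f g else 0)
      = ∑ e ∈ N, ∑ W ∈ N.powersetCard w,
        if P f g ∧ f ≠ g ∧ f ∈ insert e W ∧ g ∈ insert e W then a e else 0 := by
    intro f g
    by_cases h : P f g
    · simp [h, pairCost]
    · simp [h]
  simp only [h1]
  rw [← sum_product', univ_product_univ, sum_comm]
  refine sum_congr rfl fun e _ => ?_
  rw [sum_comm]
  refine sum_congr rfl fun W _ => ?_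
  rw [← sum_filter, sum_const, nsmul_eq_mul, mul_comm]
  congr 2
  congr 1
  ext z
  simp only [mem_filter, mem_univ, true_and, mem_offDiag]
  tauto

theorem sum_pairCost_le [Fintype β] (w : ℕ) (N : Finset β) (a : β → ℝ) (ha : ∀ e, 0 ≤ a e) :
    ∑ f, ∑ g, pairCost w N a f g ≤ ((w : ℝ) + 1) * w * (N.card.choose w * ∑ e ∈ N, a e) := by
  have h := sum_pairCost_filter w N a (fun _ _ => True)
  simp only [if_true, filter_true] at h
  rw [h, mul_sum, mul_sum]
  refine sum_le_sum fun e _ => ?_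
  have h2 : ∀ W ∈ N.powersetCard w, a e * ((insert e W).offDiag.card : ℝ)
      ≤ a e * (((w : ℝ) + 1) * w) := by
    intro W hW
    refine mul_le_mul_of_nonneg_left ?_ (ha e)
    have hc : (insert e W).card ≤ w + 1 := by
      rw [← (mem_powersetCard.1 hW).2]; exact card_insert_le e W
    have h3 : (insert e W).offDiag.card ≤ (w + 1) * w := by
      rw [offDiag_card]
      calc _ = (insert e W).card * ((insert e W).card - 1) := by
            rw [Nat.mul_sub, mul_one]
        _ ≤ (w + 1) * w := Nat.mul_le_mul hc (by omega)
    exact_mod_cast h3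
  refine (sum_le_sum h2).trans (le_of_eq ?_)
  rw [sum_const, card_powersetCard, nsmul_eq_mul]
  ring

/-- This is the weight of the degenerate pairs: for e ∈ W the set `insert e W` has only `w` elements
and one survival factor is missing. -/
theorem sum_powersetCard_mem {w : ℕ} (hw : 1 ≤ w) (N : Finset β) (a : β → ℝ) :
    ∑ e ∈ N, ∑ W ∈ N.powersetCard w, a e * (if e ∈ W then 1 else 0)
      = (N.card - 1).choose (w - 1) * ∑ e ∈ N, a e := by
  rw [mul_sum]
  refine sum_congr rfl fun e he => ?_
  rw [← mul_sum, mul_comm]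
  congr 1
  rw [sum_boole]
  have h := card_filter_powersetCard_subset {e} N w (by simpa using he) (by simpa using hw)
  simp only [singleton_subset_iff, card_singleton] at h
  rw [h]

end PairCost

/-! ### The estimator with one variable per color. -/

section Poly

variable {β γ : Type*} [DecidableEq β] [DecidableEq γ]

/-- The elements of `U` of least identifier among the elements of `U` of the same color. -/
def reps (id chi : β → ℕ) (U : Finset β) : Finset β :=
  U.filter (fun f => ∀ g ∈ U, chi g = chi f → id f ≤ id g)

/-- The estimator for the sum of `a e` over the pairs `(e, W)` of an element `e` and a
`w`-element subset `W` of `N` that survive, if `f` survives with probability `y f`: of each color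
only the representative is taken into account. -/
def poly (w : ℕ) (N : Finset β) (a : β → ℝ) (id chi : β → ℕ) (y : β → ℝ) : ℝ :=
  ∑ e ∈ N, ∑ W ∈ N.powersetCard w, a e * ∏ f ∈ reps id chi (insert e W), y f

theorem reps_map (φ : β ↪ γ) (id chi : γ → ℕ) (U : Finset β) :
    reps id chi (U.map φ) = (reps (fun e => id (φ e)) (fun e => chi (φ e)) U).map φ := by
  simp only [reps, filter_map, forall_mem_map]
  rfl

theorem poly_map (w : ℕ) (φ : β ↪ γ) (N : Finset β) (a : γ → ℝ) (id chi : γ → ℕ) (y : γ → ℝ) :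
    poly w (N.map φ) a id chi y
      = poly w N (fun e => a (φ e)) (fun e => id (φ e)) (fun e => chi (φ e))
          (fun e => y (φ e)) := by
  simp only [poly, powersetCard_map, sum_map]
  refine sum_congr rfl fun e _ => sum_congr rfl fun W _ => ?_
  simp only [RelEmbedding.coe_toEmbedding, mapEmbedding_apply, ← map_insert, reps_map, prod_map]

theorem reps_subset (id chi : β → ℕ) (U : Finset β) : reps id chi U ⊆ U := filter_subset _ _

theorem reps_injOn (id chi : β → ℕ) {U : Finset β} (hid : Set.InjOn id U) :
    Set.InjOn chi (reps id chi U) := by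
  intro f hf g hg h
  simp only [reps, coe_filter, Set.mem_ofPred_eq] at hf hg
  exact hid hf.1 hg.1 (le_antisymm (hf.2 g hg.1 h.symm) (hg.2 f hf.1 h))

/-- An element that is not a representative is charged to the couple formed with an element of its
color and of smaller identifier; the first component makes the charging injective. -/
theorem card_le_card_reps_add (id chi : β → ℕ) (U : Finset β) :
    U.card ≤ (reps id chi U).card
      + (U.offDiag.filter (fun z => chi z.1 = chi z.2)).card := by
  have h : (U \ reps id chi U).card ≤ (U.offDiag.filter (fun z => chi z.1 = chi z.2)).card := by
    have hex : ∀ f : β, ∃ g : β, f ∈ U \ reps id chi U → g ∈ U ∧ chi g = chi f ∧ id g < id f := by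
      intro f
      by_cases hf : f ∈ U \ reps id chi U
      · simp only [reps, mem_sdiff, mem_filter, not_and, not_forall, not_le] at hf
        obtain ⟨g, hg, hchi, hlt⟩ := hf.2 hf.1
        exact ⟨g, fun _ => ⟨hg, hchi, hlt⟩⟩
      · exact ⟨f, fun h => (hf h).elim⟩
    choose G hG using hex
    refine card_le_card_of_injOn (fun f => (f, G f)) ?_ ?_
    · intro f hf
      obtain ⟨h1, h2, h3⟩ := hG f hf
      simp only [coe_filter, Set.mem_ofPred_eq, mem_offDiag]
      refine ⟨⟨(mem_sdiff.1 hf).1, h1, ?_⟩, h2.symm⟩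
      intro hfg
      rw [← hfg] at h3
      exact lt_irrefl _ h3
    · intro f _ g _ hfg
      exact (Prod.ext_iff.1 hfg).1
  have h2 := card_sdiff_add_card_eq_card (reps_subset id chi U)
  omega

/-- Here p = 2^{-1/m}, so p^k = p^m 2^t with t = (m - k)/m in [0, 1], and convexity gives 2^t ≤ 1 +
t. A missing factor costs only 1/m in relative terms, which is the reason for taking small steps
instead of halving at once. -/
theorem pow_le_pow_mul_one_add {p : ℝ} {m k : ℕ} (hp : 0 < p) (hpm : p ^ m = 1 / 2) (hm : 1 ≤ m)
    (hk : k ≤ m) : p ^ k ≤ p ^ m * (1 + ((m : ℝ) - k) / m) := by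
  have hm' : (0 : ℝ) < m := by exact_mod_cast hm
  have hk' : (k : ℝ) ≤ m := by exact_mod_cast hk
  set t : ℝ := ((m : ℝ) - k) / m with ht
  have ht0 : 0 ≤ t := div_nonneg (by linarith) hm'.le
  have ht1 : t ≤ 1 := by rw [ht, div_le_one hm']; linarith [(Nat.cast_nonneg k : (0 : ℝ) ≤ k)]
  have h1 : (2 : ℝ) ^ t ≤ 1 + t := by
    have := rpow_one_add_le_one_add_mul_self (s := 1) (by norm_num) ht0 ht1
    norm_num at this
    exact this
  have hpe : p = (2 : ℝ) ^ (-(1 / (m : ℝ))) := by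
    have h2 : p ^ m = ((2 : ℝ) ^ (-(1 / (m : ℝ)))) ^ m := by
      rw [← Real.rpow_natCast ((2 : ℝ) ^ (-(1 / (m : ℝ)))), ← Real.rpow_mul (by norm_num), hpm]
      rw [neg_mul, one_div_mul_cancel hm'.ne', Real.rpow_neg_one]
      norm_num
    exact (pow_left_inj₀ hp.le (by positivity) (by omega)).1 h2
  have h3 : p ^ k = p ^ m * (2 : ℝ) ^ t := by
    rw [hpe, ← Real.rpow_natCast, ← Real.rpow_natCast, ← Real.rpow_mul (by norm_num),
      ← Real.rpow_mul (by norm_num), ← Real.rpow_add (by norm_num)]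
    congr 1
    rw [ht]
    field_simp
    ring
  rw [h3]
  exact mul_le_mul_of_nonneg_left h1 (by positivity)

/-- The value of the estimator at the constant probability `p`. -/
theorem poly_const_le [Fintype β] {w : ℕ} (hw : 1 ≤ w) (N : Finset β) (a : β → ℝ)
    (ha : ∀ e, 0 ≤ a e) (id chi : β → ℕ) {p : ℝ} (hp : 0 < p) (hpw : p ^ (w + 1) = 1 / 2)
    (y : β → ℝ) (hy : ∀ f ∈ N, y f = p) :
    poly w N a id chi y
      ≤ 1 / 2 * (N.card.choose w * (∑ e ∈ N, a e)
          + (N.card - 1).choose (w - 1) * (∑ e ∈ N, a e) / (w + 1)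
          + (∑ f, ∑ g, if chi f = chi g then pairCost w N a f g else 0) / (w + 1)) := by
  rw [sum_pairCost_filter, ← sum_powersetCard_mem hw]
  have h1 : (N.card.choose w : ℝ) * (∑ e ∈ N, a e) = ∑ e ∈ N, ∑ W ∈ N.powersetCard w, a e := by
    rw [mul_sum]
    refine sum_congr rfl fun e _ => ?_
    rw [sum_const, card_powersetCard, nsmul_eq_mul]
  rw [h1, sum_div, sum_div, ← sum_add_distrib, ← sum_add_distrib, mul_sum, poly]
  refine sum_le_sum fun e he => ?_
  rw [sum_div, sum_div, ← sum_add_distrib, ← sum_add_distrib, mul_sum]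
  refine sum_le_sum fun W hW => ?_
  obtain ⟨hWN, hWc⟩ := mem_powersetCard.1 hW
  set U := insert e W with hU
  have hUN : U ⊆ N := insert_subset he hWN
  have hprod : ∏ f ∈ reps id chi U, y f = p ^ (reps id chi U).card := by
    rw [← prod_const]
    exact prod_congr rfl fun f hf => hy f (hUN (reps_subset _ _ _ hf))
  have hUc : U.card + (if e ∈ W then 1 else 0) = w + 1 := by
    by_cases h : e ∈ W
    · simp [hU, h, hWc]
    · simp [hU, h, hWc]
  have hk := card_le_card (reps_subset id chi U)
  have hk' := card_le_card_reps_add id chi U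
  set k := (reps id chi U).card
  set mo := (U.offDiag.filter (fun z => chi z.1 = chi z.2)).card
  have hkw : k ≤ w + 1 := by omega
  have hpow := pow_le_pow_mul_one_add hp hpw (by omega) hkw
  -- A factor is missing either because e ∈ W or because a member of `U` is represented by another
  -- one of its color.
  have hle : ((w : ℝ) + 1) - k ≤ (if e ∈ W then 1 else 0) + mo := by
    have : w + 1 ≤ k + (if e ∈ W then 1 else 0) + mo := by omega
    have h2 : ((w + 1 : ℕ) : ℝ) ≤ ((k + (if e ∈ W then 1 else 0) + mo : ℕ) : ℝ) := by
      exact_mod_cast this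
    push_cast at h2
    linarith
  rw [hprod]
  have hw0 : (0 : ℝ) < (w : ℝ) + 1 := by positivity
  calc a e * p ^ k ≤ a e * (1 / 2 * (1 + ((if e ∈ W then 1 else 0) + mo) / (w + 1))) := by
        refine mul_le_mul_of_nonneg_left (hpow.trans ?_) (ha e)
        rw [hpw]
        push_cast
        gcongr
    _ = _ := by ring

/-- The estimator is affine in the values of one color class. -/
theorem poly_sub_poly (w : ℕ) (N : Finset β) (a : β → ℝ) (id chi : β → ℕ)
    (hid : Set.InjOn id N) (t : ℕ) (y y' : β → ℝ) (hyy : ∀ f ∈ N, chi f ≠ t → y' f = y f) :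
    poly w N a id chi y' - poly w N a id chi y
      = ∑ e ∈ N.filter (fun e => chi e = t), (y' e - y e)
          * (poly w N a id chi (Function.update y e 1)
            - poly w N a id chi (Function.update y e 0)) := by
  -- If the colors on `R` are distinct, the product contains at most one variable of color `t`.
  -- Changing the whole class therefore creates no cross terms.
  have hmono : ∀ R ⊆ N, Set.InjOn chi R → ∏ f ∈ R, y' f - ∏ f ∈ R, y f
      = ∑ e ∈ N.filter (fun e => chi e = t), (y' e - y e)
        * (∏ f ∈ R, Function.update y e 1 f - ∏ f ∈ R, Function.update y e 0 f) := by
    intro R hRN hR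
    have hz : ∀ e, e ∉ R → ∀ u : ℝ, ∏ f ∈ R, Function.update y e u f = ∏ f ∈ R, y f := by
      intro e he u
      refine prod_congr rfl fun f hf => Function.update_of_ne ?_ _ _
      rintro rfl
      exact he hf
    by_cases hex : ∃ e ∈ R, chi e = t
    · obtain ⟨e, heR, het⟩ := hex
      have hne : ∀ f ∈ R.erase e, chi f ≠ t := by
        intro f hf h
        rw [mem_erase] at hf
        exact hf.1 (hR hf.2 heR (h.trans het.symm))
      rw [sum_eq_single_of_mem e (mem_filter.2 ⟨hRN heR, het⟩)]
      · have h1 : ∀ u : ℝ, ∏ f ∈ R, Function.update y e u f = u * ∏ f ∈ R.erase e, y f := by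
          intro u
          rw [← mul_prod_erase R _ heR, Function.update_self]
          congr 1
          exact prod_congr rfl fun f hf => Function.update_of_ne (ne_of_mem_erase hf) _ _
        rw [h1, h1, ← mul_prod_erase R y heR, ← mul_prod_erase R y' heR]
        have h2 : ∏ f ∈ R.erase e, y' f = ∏ f ∈ R.erase e, y f :=
          prod_congr rfl fun f hf => hyy f (hRN (mem_of_mem_erase hf)) (hne f hf)
        rw [h2]
        ring
      · intro f hf hfe
        have : f ∉ R := fun h => hfe (hR h heR ((mem_filter.1 hf).2.trans het.symm))
        rw [hz f this, hz f this, sub_self, mul_zero]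
    · push Not at hex
      rw [sum_eq_zero, sub_eq_zero]
      · exact prod_congr rfl fun f hf => hyy f (hRN hf) (hex f hf)
      · intro f hf
        have : f ∉ R := fun h => hex f h (mem_filter.1 hf).2
        rw [hz f this, hz f this, sub_self, mul_zero]
  have hterm : ∀ e ∈ N, ∀ W ∈ N.powersetCard w,
      a e * ∏ f ∈ reps id chi (insert e W), y' f - a e * ∏ f ∈ reps id chi (insert e W), y f
      = ∑ e' ∈ N.filter (fun e => chi e = t), (y' e' - y e')
        * (a e * ∏ f ∈ reps id chi (insert e W), Function.update y e' 1 f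
          - a e * ∏ f ∈ reps id chi (insert e W), Function.update y e' 0 f) := by
    intro e he W hW
    have hsub : insert e W ⊆ N := insert_subset he (mem_powersetCard.1 hW).1
    rw [← mul_sub, hmono _ ((reps_subset _ _ _).trans hsub)
      (reps_injOn id chi (hid.mono (by exact_mod_cast hsub))), mul_sum]
    refine sum_congr rfl fun e' _ => ?_
    ring
  simp only [poly, ← sum_sub_distrib]
  simp only [mul_sum]
  symm
  rw [sum_comm]
  refine sum_congr rfl fun e he => ?_
  rw [sum_comm]
  exact sum_congr rfl fun W hW => (hterm e he W hW).symm

/-- At a vector of zeros and ones the estimator bounds what survives. -/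
theorem le_poly_of_zero_one (w : ℕ) (N N' : Finset β) (a : β → ℝ) (ha : ∀ e, 0 ≤ a e)
    (id chi : β → ℕ) (y : β → ℝ) (hN' : N' ⊆ N) (h1 : ∀ f ∈ N', y f = 1) (h0 : ∀ f, 0 ≤ y f) :
    (N'.card.choose w : ℝ) * ∑ e ∈ N', a e ≤ poly w N a id chi y := by
  have hnn : ∀ e W, 0 ≤ a e * ∏ f ∈ reps id chi (insert e W), y f :=
    fun e W => mul_nonneg (ha e) (prod_nonneg fun f _ => h0 f)
  calc (N'.card.choose w : ℝ) * ∑ e ∈ N', a e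
      = ∑ e ∈ N', ∑ W ∈ N'.powersetCard w, a e * ∏ f ∈ reps id chi (insert e W), y f := by
        rw [mul_sum]
        refine sum_congr rfl fun e he => ?_
        rw [← nsmul_eq_mul, ← card_powersetCard, ← sum_const]
        refine sum_congr rfl fun W hW => ?_
        rw [prod_eq_one, mul_one]
        intro f hf
        exact h1 f (insert_subset he (mem_powersetCard.1 hW).1 (reps_subset _ _ _ hf))
    _ ≤ ∑ e ∈ N', ∑ W ∈ N.powersetCard w, a e * ∏ f ∈ reps id chi (insert e W), y f :=
        sum_le_sum fun e _ =>
          sum_le_sum_of_subset_of_nonneg (powersetCard_mono hN') fun W _ _ => hnn e W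
    _ ≤ _ := sum_le_sum_of_subset_of_nonneg hN' fun e _ _ => sum_nonneg fun W _ => hnn e W

end Poly

end LocalRounding

/-! ### Labels of hyperedges and the rules of the algorithm. -/

namespace LocalRounding

open Finset

/-- The label of a hyperedge: its identifier and its input, the colors `psi`, `nw` and `chi` that
it has computed, and its probability `y` of survival. -/
structure Label where
  id : ℕ
  color : ℕ
  weight : ℝ
  active : Bool
  psi : ℕ
  nw : ℕ
  chi : ℕ
  y : ℝ

noncomputable instance : DecidableEq Label := Classical.decEq _

/-- The active labels of a set. -/
def actives (N : Finset Label) : Finset Label := N.filter (fun z => z.active = true)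

/-- The total cost of the pairs of `x` with the active labels around it that satisfy `h`. -/
noncomputable def conflict (w : ℕ) (x : Label) (vw : Finset (ℕ × Finset Label)) (h : Label → Prop)
    [DecidablePred h] : ℝ :=
  ∑ p ∈ vw, ∑ z ∈ actives p.2, if h z then pairCost w (actives p.2) Label.weight x z else 0

/-- The hyperedge picks the best position of its code word. -/
noncomputable def codeRule (w n : ℕ) (φ : ℕ → ℕ → ℕ) (src : Label → ℕ) : Rule Label :=
  fun x vw =>
    let k := argmin n (fun k => conflict w x vw
      (fun z => z.chi = x.chi ∧ src z ≠ src x ∧ φ (src z) k = φ (src x) k))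
    { x with psi := k * n + φ (src x) k }

/-- The hyperedges with `psi = t` pick the best of `q` values. -/
noncomputable def greedyRule (w q t : ℕ) : Rule Label :=
  fun x vw =>
    if x.psi = t then
      { x with nw := argmin q (fun k => conflict w x vw
          (fun z => z.chi = x.chi ∧ z.psi < x.psi ∧ z.nw = k)) }
    else x

/-- The color `nw` refines the color `chi`. -/
def mergeRule (q : ℕ) : Rule Label := fun x _ => { x with chi := x.chi * q + x.nw }

/-- All hyperedges survive with probability `p`. -/
def initRule (p : ℝ) : Rule Label := fun x _ => { x with y := p }

/-- The effect on the objective of setting the probability of `x` to `1` instead of `0`. -/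
noncomputable def gain (w : ℕ) (A M N : ℝ) (x : Label) (vw : Finset (ℕ × Finset Label)) : ℝ :=
  A * x.weight - ∑ p ∈ vw, (M * x.weight
    + N * (poly w (actives p.2) Label.weight Label.id Label.chi
        (fun z => if z.id = x.id then 1 else z.y)
      - poly w (actives p.2) Label.weight Label.id Label.chi
        (fun z => if z.id = x.id then 0 else z.y)))

/-- The hyperedges of color `t` decide whether they survive. -/
noncomputable def decideRule (w : ℕ) (A M N : ℝ) (t : ℕ) : Rule Label :=
  fun x vw => if x.chi = t then { x with y := if 0 ≤ gain w A M N x vw then 1 else 0 } else x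

open Classical in
/-- The survivors form the new set of active hyperedges. -/
noncomputable def finishRule : Rule Label :=
  fun x _ => { x with active := x.active && decide (x.y = 1), chi := 0 }

/-! ### What the coloring rules compute on a hypergraph. -/

section Semantics

variable {V E : Type*} [Fintype V] [Fintype E] [DecidableEq V] [DecidableEq E]
  {H : MultiHypergraph V E} {ident c : V ⊕ E → ℕ} {a : E → ℝ} {L : Finset E} {l l' : E → Label}

/-- The hyperedges of `L` that contain `v`. -/
def star (H : MultiHypergraph V E) (L : Finset E) (v : V) : Finset E :=
  L.filter (fun e => v ∈ H.verts e)

/-- The total cost of a pair of hyperedges. -/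
def cost (H : MultiHypergraph V E) (w : ℕ) (a : E → ℝ) (L : Finset E) (f g : E) : ℝ :=
  ∑ v, pairCost w (star H L v) a f g

/-- The labels hold the identifiers, the inputs and the current set of hyperedges. -/
structure Consistent (ident c : V ⊕ E → ℕ) (a : E → ℝ) (L : Finset E) (l : E → Label) : Prop where
  id_eq : ∀ e, (l e).id = ident (Sum.inr e)
  color_eq : ∀ e, (l e).color = c (Sum.inr e)
  weight_eq : ∀ e, (l e).weight = a e
  active_iff : ∀ e, (l e).active = true ↔ e ∈ L

/-- The stored identifier separates hyperedges that agree in everything else, so sets of labels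
represent sets of hyperedges faithfully. -/
theorem Consistent.injective (hl : Consistent ident c a L l) (hid : Function.Injective ident) :
    Function.Injective l := by
  intro e e' h
  have := congrArg Label.id h
  rw [hl.id_eq, hl.id_eq] at this
  exact Sum.inr_injective (hid this)

/-- The vertex identifiers in a view keep apart vertices that have collected the same labels. -/
theorem sum_view (hid : Function.Injective ident) (l : E → Label) (e : E)
    (F : Finset Label → ℝ) :
    ∑ p ∈ view H ident l e, F p.2 = ∑ v ∈ H.verts e, F ((H.edgesAt v).image l) := by
  rw [view, sum_image]
  intro v _ v' _ h
  exact Sum.inl_injective (hid (Prod.ext_iff.1 h).1)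

theorem Consistent.actives_image (hl : Consistent ident c a L l) (hid : Function.Injective ident)
    (v : V) :
    actives ((H.edgesAt v).image l) = (star H L v).map ⟨l, hl.injective hid⟩ := by
  ext z
  simp only [actives, star, mem_filter, mem_image, mem_map, Function.Embedding.coeFn_mk,
    MultiHypergraph.mem_edgesAt]
  constructor
  · rintro ⟨⟨e, he, rfl⟩, hz⟩
    exact ⟨e, ⟨(hl.active_iff e).1 hz, he⟩, rfl⟩
  · rintro ⟨e, ⟨he, hv⟩, rfl⟩
    exact ⟨⟨e, hv, rfl⟩, (hl.active_iff e).2 he⟩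

theorem cost_nonneg (H : MultiHypergraph V E) (w : ℕ) (ha : ∀ e, 0 ≤ a e) (L : Finset E)
    (f g : E) : 0 ≤ cost H w a L f g :=
  sum_nonneg fun _ _ => pairCost_nonneg w _ a ha f g

theorem cost_comm (H : MultiHypergraph V E) (w : ℕ) (L : Finset E) (f g : E) :
    cost H w a L f g = cost H w a L g f :=
  sum_congr rfl fun _ _ => pairCost_comm w _ a f g

theorem exists_common_vertex {w : ℕ} {f g : E} (h : cost H w a L f g ≠ 0) :
    f ≠ g ∧ ∃ v, v ∈ H.verts f ∧ v ∈ H.verts g := by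
  obtain ⟨v, _, hv⟩ := exists_ne_zero_of_sum_ne_zero h
  have h1 : ¬ (f = g ∨ f ∉ star H L v ∨ g ∉ star H L v) :=
    fun h => hv (pairCost_eq_zero w _ a f g h)
  push Not at h1
  exact ⟨h1.1, v, (mem_filter.1 h1.2.1).2, (mem_filter.1 h1.2.2).2⟩

/-- A single view suffices to know the cost of `e` against every `g`: only vertices of `e` and
hyperedges in their stars contribute, so the local sums extend by zeros. -/
theorem Consistent.conflict_eq (hl : Consistent ident c a L l) (hid : Function.Injective ident)
    (w : ℕ) (e : E) (h : Label → Prop) [DecidablePred h] :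
    conflict w (l e) (view H ident l e) h = ∑ g, if h (l g) then cost H w a L e g else 0 := by
  have hw : (fun g => (l g).weight) = a := funext hl.weight_eq
  rw [conflict, sum_view hid l e (fun N => ∑ z ∈ actives N,
    if h z then pairCost w (actives N) Label.weight (l e) z else 0)]
  have h1 : ∀ v ∈ H.verts e, ∑ z ∈ actives ((H.edgesAt v).image l),
      (if h z then pairCost w (actives ((H.edgesAt v).image l)) Label.weight (l e) z else 0)
      = ∑ g, if h (l g) then pairCost w (star H L v) a e g else 0 := by
    intro v _
    rw [hl.actives_image hid v, sum_map]
    have h2 : ∀ g, pairCost w ((star H L v).map ⟨l, hl.injective hid⟩) Label.weight (l e) (l g)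
        = pairCost w (star H L v) a e g := by
      intro g
      have := pairCost_map w ⟨l, hl.injective hid⟩ (star H L v) Label.weight e g
      simp only [Function.Embedding.coeFn_mk, hw] at this
      exact this
    simp only [Function.Embedding.coeFn_mk, h2]
    refine sum_subset (subset_univ _) fun g _ hg => ?_
    rw [pairCost_eq_zero w _ a e g (Or.inr (Or.inr hg)), ite_self]
  rw [sum_congr rfl h1, sum_comm]
  refine sum_congr rfl fun g _ => ?_
  by_cases hg : h (l g)
  · simp only [hg, if_true, cost]
    refine sum_subset (subset_univ _) fun v _ hv => ?_
    refine pairCost_eq_zero w _ a e g (Or.inr (Or.inl fun h => hv (mem_filter.1 h).2))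
  · simp [hg]

theorem applyRule_codeRule (hl : Consistent ident c a L l) (hid : Function.Injective ident)
    (ha : ∀ e, 0 ≤ a e) (w : ℕ) {M n q : ℕ} (hn : 0 < n) (hq : 0 < q) (φ : ℕ → ℕ → ℕ)
    (hφ : ∀ κ k, φ κ k < n)
    (hcode : ∀ κ < M, ∀ κ' < M, κ ≠ κ' →
        q * ((range n).filter (fun k => φ κ k = φ κ' k)).card ≤ n)
    (src : Label → ℕ) (hsrc : ∀ e, src (l e) < M)
    (hl' : l' = applyRule H ident (codeRule w n φ src) l) :
    (∀ e, l' e = { l e with psi := (l' e).psi }) ∧ (∀ e, (l' e).psi < n * n) ∧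
    monoCost (cost H w a L) (fun e => ((l' e).chi, (l' e).psi))
      ≤ monoCost (cost H w a L) (fun e => ((l e).chi, src (l e)))
        + 1 / q * monoCost (cost H w a L) (fun e => (l e).chi) := by
  subst hl'
  set F : E → ℕ → ℝ := fun f k => ∑ g, if (l g).chi = (l f).chi ∧ src (l g) ≠ src (l f)
    ∧ φ (src (l g)) k = φ (src (l f)) k then cost H w a L f g else 0 with hF
  have hpsi : ∀ e, applyRule H ident (codeRule w n φ src) l e
      = { l e with psi := argmin n (F e) * n + φ (src (l e)) (argmin n (F e)) } := by
    intro e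
    simp only [applyRule, codeRule, hl.conflict_eq hid, hF]
  simp only [hpsi]
  refine ⟨fun e => trivial, fun e => ?_, ?_⟩
  · have h1 := (argmin_spec hn (F e)).1
    have h2 := hφ (src (l e)) (argmin n (F e))
    calc _ < argmin n (F e) * n + n := by omega
      _ = (argmin n (F e) + 1) * n := by ring
      _ ≤ n * n := Nat.mul_le_mul_right n h1
  · exact monoCost_code_le (cost H w a L) (cost_nonneg H w ha L) (fun e => (l e).chi)
      (fun e => src (l e)) (fun e => argmin n (F e)) hn hq φ hφ hcode hsrc
      (fun f => mul_argmin_le_sum hn (F f))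

theorem Consistent.of_eq (hl : Consistent ident c a L l)
    (h1 : ∀ e, (l' e).id = (l e).id) (h2 : ∀ e, (l' e).color = (l e).color)
    (h3 : ∀ e, (l' e).weight = (l e).weight) (h4 : ∀ e, (l' e).active = (l e).active) :
    Consistent ident c a L l' where
  id_eq e := by rw [h1, hl.id_eq]
  color_eq e := by rw [h2, hl.color_eq]
  weight_eq e := by rw [h3, hl.weight_eq]
  active_iff e := by rw [h4, hl.active_iff]

/-- When the class `psi = t` chooses, all smaller classes hold their final values, and later rules
do not touch them. The averaging bound valid at the time of the choice therefore persists. -/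
theorem runRules_greedyRule (hl : Consistent ident c a L l) (hid : Function.Injective ident)
    (ha : ∀ e, 0 ≤ a e) (w : ℕ) {q : ℕ} (hq : 0 < q) (t : ℕ)
    (hl' : l' = runRules H ident ((List.range t).map (greedyRule w q)) l) :
    (∀ e, l' e = { l e with nw := (l' e).nw }) ∧ ∀ f, (l f).psi < t → (l' f).nw < q ∧
      q * ∑ g, (if (l g).chi = (l f).chi ∧ (l g).psi < (l f).psi ∧ (l' g).nw = (l' f).nw
        then cost H w a L f g else 0)
      ≤ ∑ g, (if (l g).chi = (l f).chi ∧ (l g).psi < (l f).psi then cost H w a L f g else 0) := by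
  induction t generalizing l' with
  | zero =>
    subst hl'
    exact ⟨fun e => rfl, fun f hf => absurd hf (Nat.not_lt_zero _)⟩
  | succ t ih =>
    rw [runRules_map_range_succ] at hl'
    set m := runRules H ident ((List.range t).map (greedyRule w q)) l with hm
    obtain ⟨ih1, ih2⟩ := ih rfl
    have hmc : Consistent ident c a L m :=
      hl.of_eq (fun e => by rw [ih1]) (fun e => by rw [ih1]) (fun e => by rw [ih1])
        (fun e => by rw [ih1])
    have hmchi : ∀ e, (m e).chi = (l e).chi := fun e => by rw [ih1]
    have hmpsi : ∀ e, (m e).psi = (l e).psi := fun e => by rw [ih1]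
    set F : E → ℕ → ℝ := fun f k => ∑ g, if (l g).chi = (l f).chi ∧ (l g).psi < (l f).psi
      ∧ (m g).nw = k then cost H w a L f g else 0 with hF
    have hstep : ∀ e, l' e = if (l e).psi = t then { m e with nw := argmin q (F e) } else m e := by
      intro e
      rw [hl']
      simp only [applyRule, greedyRule, hmc.conflict_eq hid, hmchi, hmpsi, hF]
    have hkeep : ∀ e, (l e).psi < t → (l' e).nw = (m e).nw := by
      intro e he
      rw [hstep, if_neg he.ne]
    refine ⟨fun e => ?_, fun f hf => ?_⟩
    · rw [hstep]
      split_ifs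
      · rw [ih1]
      · exact ih1 e
    · rcases Nat.lt_succ_iff_lt_or_eq.1 hf with hlt | heq
      · obtain ⟨h1, h2⟩ := ih2 f hlt
        rw [hkeep f hlt]
        refine ⟨h1, le_trans (le_of_eq ?_) h2⟩
        congr 1
        refine sum_congr rfl fun g _ => ?_
        by_cases hg : (l g).psi < (l f).psi
        · rw [hkeep g (hg.trans hlt)]
        · simp [hg]
      · have hnw : (l' f).nw = argmin q (F f) := by rw [hstep, if_pos heq]
        rw [hnw]
        refine ⟨(argmin_spec hq _).1, ?_⟩
        have h1 : ∑ g, (if (l g).chi = (l f).chi ∧ (l g).psi < (l f).psi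
            ∧ (l' g).nw = argmin q (F f) then cost H w a L f g else 0) = F f (argmin q (F f)) := by
          simp only [hF]
          refine sum_congr rfl fun g _ => ?_
          by_cases hg : (l g).psi < (l f).psi
          · rw [hkeep g (heq ▸ hg)]
          · simp [hg]
        rw [h1]
        refine (mul_argmin_le_sum hq (F f)).trans ?_
        simp only [hF]
        rw [sum_comm]
        refine sum_le_sum fun g _ => ?_
        have hcost := cost_nonneg H w ha L f g
        by_cases hg : (l g).chi = (l f).chi ∧ (l g).psi < (l f).psi
        · simp only [hg.1, hg.2, true_and, and_self, if_true]
          rw [sum_ite_eq]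
          split_ifs <;> linarith
        · rw [if_neg hg, sum_eq_zero]
          intro k _
          exact if_neg fun h => hg ⟨h.1, h.2.1⟩

/-- The rules that refine the coloring `chi` by a factor of `q`. -/
noncomputable def refineRules (w q n₁ n₂ : ℕ) (φ₁ φ₂ : ℕ → ℕ → ℕ) : List (Rule Label) :=
  codeRule w n₁ φ₁ Label.color :: codeRule w n₂ φ₂ Label.psi ::
    ((List.range (n₂ * n₂)).map (greedyRule w q) ++ [mergeRule q])

/-- The fraction 3/q collects 1/q from each of the two code reductions and 1/q from the greedy
choice. The second reduction serves to shorten the greedy loop, whose length is the number of `psi`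
values. -/
theorem runRules_refineRules (hl : Consistent ident c a L l) (hid : Function.Injective ident)
    (ha : ∀ e, 0 ≤ a e) (w : ℕ) {M n₁ n₂ q : ℕ} (hn₁ : 0 < n₁) (hn₂ : 0 < n₂) (hq : 0 < q)
    (φ₁ φ₂ : ℕ → ℕ → ℕ) (hφ₁ : ∀ κ k, φ₁ κ k < n₁) (hφ₂ : ∀ κ k, φ₂ κ k < n₂)
    (hcode₁ : ∀ κ < M, ∀ κ' < M, κ ≠ κ' →
        q * ((range n₁).filter (fun k => φ₁ κ k = φ₁ κ' k)).card ≤ n₁)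
    (hcode₂ : ∀ κ < n₁ * n₁, ∀ κ' < n₁ * n₁, κ ≠ κ' →
        q * ((range n₂).filter (fun k => φ₂ κ k = φ₂ κ' k)).card ≤ n₂)
    (hcM : ∀ e, c (Sum.inr e) < M)
    (hproper : ∀ f g, f ≠ g → (∃ v, v ∈ H.verts f ∧ v ∈ H.verts g) → c (Sum.inr f) ≠ c (Sum.inr g))
    {B : ℕ} (hB : ∀ e, (l e).chi < B)
    (hl' : l' = runRules H ident (refineRules w q n₁ n₂ φ₁ φ₂) l) :
    Consistent ident c a L l' ∧ (∀ e, (l' e).chi < B * q) ∧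
    monoCost (cost H w a L) (fun e => (l' e).chi)
      ≤ 3 / q * monoCost (cost H w a L) (fun e => (l e).chi) := by
  rw [refineRules, runRules_cons, runRules_cons, runRules_append] at hl'
  set l₁ := applyRule H ident (codeRule w n₁ φ₁ Label.color) l with hl₁
  obtain ⟨h1, h1b, h1m⟩ := applyRule_codeRule hl hid ha w hn₁ hq φ₁ hφ₁ hcode₁ Label.color
    (fun e => by rw [hl.color_eq]; exact hcM e) hl₁
  have hc₁ : Consistent ident c a L l₁ := hl.of_eq (fun e => by rw [h1]) (fun e => by rw [h1])
    (fun e => by rw [h1]) (fun e => by rw [h1])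
  set l₂ := applyRule H ident (codeRule w n₂ φ₂ Label.psi) l₁ with hl₂
  obtain ⟨h2, h2b, h2m⟩ := applyRule_codeRule hc₁ hid ha w hn₂ hq φ₂ hφ₂ hcode₂ Label.psi
    h1b hl₂
  have hc₂ : Consistent ident c a L l₂ := hc₁.of_eq (fun e => by rw [h2]) (fun e => by rw [h2])
    (fun e => by rw [h2]) (fun e => by rw [h2])
  set l₃ := runRules H ident ((List.range (n₂ * n₂)).map (greedyRule w q)) l₂ with hl₃
  obtain ⟨h3, h3m⟩ := runRules_greedyRule hc₂ hid ha w hq (n₂ * n₂) hl₃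
  have hc₃ : Consistent ident c a L l₃ := hc₂.of_eq (fun e => by rw [h3]) (fun e => by rw [h3])
    (fun e => by rw [h3]) (fun e => by rw [h3])
  have hl'' : ∀ e, l' e = { l₃ e with chi := (l₃ e).chi * q + (l₃ e).nw } := by
    intro e; rw [hl']; rfl
  have hchi₁ : ∀ e, (l₁ e).chi = (l e).chi := fun e => by rw [h1]
  have hchi₂ : ∀ e, (l₂ e).chi = (l e).chi := fun e => by rw [h2, hchi₁]
  have hchi₃ : ∀ e, (l₃ e).chi = (l e).chi := fun e => by rw [h3, hchi₂]
  have hnw : ∀ e, (l₃ e).nw < q := fun e => (h3m e (h2b e)).1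
  refine ⟨hc₃.of_eq (fun e => by rw [hl'']) (fun e => by rw [hl'']) (fun e => by rw [hl''])
    (fun e => by rw [hl'']), fun e => ?_, ?_⟩
  · rw [hl'']
    simp only [hchi₃]
    calc _ < (l e).chi * q + q := Nat.add_lt_add_left (hnw e) _
      _ = ((l e).chi + 1) * q := by ring
      _ ≤ B * q := Nat.mul_le_mul_right q (hB e)
  · set C := cost H w a L
    have hgr := monoCost_greedy_le C (cost_nonneg H w ha L) (cost_comm H w L)
      (fun e => (l₂ e).chi) (fun e => (l₂ e).psi) (fun e => (l₃ e).nw) hq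
      (fun f => (h3m f (h2b f)).2)
    -- Only hyperedges with a common vertex have a nonzero cost, and the input coloring separates
    -- these, so the reductions start without defect.
    have hz : monoCost C (fun e => ((l e).chi, (l e).color)) = 0 := by
      refine sum_eq_zero fun f _ => sum_eq_zero fun g _ => ?_
      by_contra hne
      rw [ite_eq_right_iff, Classical.not_imp] at hne
      obtain ⟨heq, hne⟩ := hne
      obtain ⟨hfg, hv⟩ := exists_common_vertex hne
      simp only [Prod.mk.injEq, hl.color_eq] at heq
      exact hproper f g hfg hv heq.2
    have hfin : monoCost C (fun e => (l' e).chi)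
        = monoCost C (fun e => ((l₂ e).chi, (l₃ e).nw)) := by
      refine sum_congr rfl fun f _ => sum_congr rfl fun g _ => if_congr ?_ rfl rfl
      simp only [hl'', hchi₃, hchi₂, Prod.mk.injEq]
      constructor
      · intro h
        have hmod := congrArg (· % q) h
        simp only [Nat.mul_add_mod_self_right, Nat.mod_eq_of_lt (hnw _)] at hmod
        rw [hmod] at h
        exact ⟨Nat.eq_of_mul_eq_mul_right hq (Nat.add_right_cancel h), hmod⟩
      · rintro ⟨h, h'⟩
        rw [h, h']
    rw [hz] at h1m
    simp only [hchi₁] at h1m h2m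
    simp only [hchi₂] at h2m hgr hfin
    rw [hfin]
    have : (3 : ℝ) / q * monoCost C (fun e => (l e).chi)
      = 1 / q * monoCost C (fun e => (l e).chi) + (1 / q * monoCost C (fun e => (l e).chi)
        + 1 / q * monoCost C (fun e => (l e).chi)) := by ring
    linarith

end Semantics

end LocalRounding

namespace LocalRounding

open Finset

/-! ### Conditional expectations along color classes, and one complete step. -/

section Decide

variable {V E : Type*} [Fintype V] [Fintype E] [DecidableEq V] [DecidableEq E]
  {H : MultiHypergraph V E} {ident c : V ⊕ E → ℕ} {a : E → ℝ} {L : Finset E} {l l' : E → Label}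

/-- The objective, a concave combination of the expected weight and of the estimators. -/
def objective (H : MultiHypergraph V E) (w : ℕ) (A M N : ℝ) (a : E → ℝ) (L : Finset E)
    (id chi : E → ℕ) (y : E → ℝ) : ℝ :=
  ∑ e ∈ L, A * a e * y e
    - ∑ v, (∑ e ∈ star H L v, M * a e * y e + N * poly w (star H L v) a id chi y)

/-- The derivative of the objective with respect to the probability of `e`. -/
def edgeGain (H : MultiHypergraph V E) (w : ℕ) (A M N : ℝ) (a : E → ℝ) (L : Finset E)
    (id chi : E → ℕ) (y : E → ℝ) (e : E) : ℝ :=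
  A * a e - ∑ v ∈ H.verts e, (M * a e
    + N * (poly w (star H L v) a id chi (Function.update y e 1)
      - poly w (star H L v) a id chi (Function.update y e 0)))

/-- The linear terms and, by `poly_sub_poly`, the estimators are affine in one color class. The
change is hence the exact sum of individual contributions, even if many hyperedges of the class move
together. -/
theorem objective_sub_objective (H : MultiHypergraph V E) (w : ℕ) (A M N : ℝ) (a : E → ℝ)
    (L : Finset E) (id chi : E → ℕ) (hid : Function.Injective id) (t : ℕ) (y y' : E → ℝ)
    (hyy : ∀ f, chi f ≠ t → y' f = y f) :
    objective H w A M N a L id chi y' - objective H w A M N a L id chi y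
      = ∑ e ∈ L.filter (fun e => chi e = t), (y' e - y e) * edgeGain H w A M N a L id chi y e := by
  have hlin : ∀ (T : Finset E) (B : ℝ), ∑ e ∈ T, B * a e * y' e - ∑ e ∈ T, B * a e * y e
      = ∑ e ∈ T.filter (fun e => chi e = t), (y' e - y e) * (B * a e) := by
    intro T B
    rw [← sum_sub_distrib, sum_filter]
    refine sum_congr rfl fun e _ => ?_
    split_ifs with h
    · ring
    · rw [hyy e h, sub_self]
  have hswap : ∀ F : V → E → ℝ, ∑ e ∈ L.filter (fun e => chi e = t), ∑ v ∈ H.verts e, F v e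
      = ∑ v, ∑ e ∈ (star H L v).filter (fun e => chi e = t), F v e := by
    intro F
    refine sum_comm' fun e v => ?_
    simp only [star, mem_filter, mem_univ]
    tauto
  have h1 : ∀ v, (∑ e ∈ star H L v, M * a e * y' e + N * poly w (star H L v) a id chi y')
      - (∑ e ∈ star H L v, M * a e * y e + N * poly w (star H L v) a id chi y)
      = ∑ e ∈ (star H L v).filter (fun e => chi e = t), (y' e - y e) * (M * a e
        + N * (poly w (star H L v) a id chi (Function.update y e 1)
          - poly w (star H L v) a id chi (Function.update y e 0))) := by
    intro v
    have h2 := hlin (star H L v) M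
    have h3 := poly_sub_poly w (star H L v) a id chi hid.injOn t y y' (fun f _ => hyy f)
    calc _ = (∑ e ∈ star H L v, M * a e * y' e - ∑ e ∈ star H L v, M * a e * y e)
        + N * (poly w (star H L v) a id chi y' - poly w (star H L v) a id chi y) := by ring
      _ = _ := by
        rw [h2, h3, mul_sum, ← sum_add_distrib]
        refine sum_congr rfl fun e _ => ?_
        ring
  simp only [edgeGain, mul_sub, sum_sub_distrib]
  simp only [← mul_sub]
  have h4 : ∑ e ∈ L.filter (fun e => chi e = t), (y' e - y e) * ∑ v ∈ H.verts e, (M * a e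
        + N * (poly w (star H L v) a id chi (Function.update y e 1)
          - poly w (star H L v) a id chi (Function.update y e 0)))
      = ∑ v, ∑ e ∈ (star H L v).filter (fun e => chi e = t), (y' e - y e) * (M * a e
        + N * (poly w (star H L v) a id chi (Function.update y e 1)
          - poly w (star H L v) a id chi (Function.update y e 0))) := by
    rw [← hswap]
    exact sum_congr rfl fun e _ => mul_sum _ _ _
  rw [h4, ← hlin, ← sum_congr rfl fun v _ => h1 v, sum_sub_distrib]
  simp only [objective]
  ring

theorem Consistent.gain_eq (hl : Consistent ident c a L l) (hid : Function.Injective ident)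
    (w : ℕ) (A M N : ℝ) (e : E) :
    gain w A M N (l e) (view H ident l e)
      = edgeGain H w A M N a L (fun e => ident (Sum.inr e)) (fun e => (l e).chi)
          (fun e => (l e).y) e := by
  have hw : (fun g => (l g).weight) = a := funext hl.weight_eq
  have hi : (fun g => (l g).id) = fun e => ident (Sum.inr e) := funext hl.id_eq
  rw [gain, edgeGain, sum_view hid l e (fun N' => M * (l e).weight
    + N * (poly w (actives N') Label.weight Label.id Label.chi
        (fun z => if z.id = (l e).id then 1 else z.y)
      - poly w (actives N') Label.weight Label.id Label.chi
        (fun z => if z.id = (l e).id then 0 else z.y))), hl.weight_eq]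
  congr 1
  refine sum_congr rfl fun v _ => ?_
  rw [hl.actives_image hid v]
  have hu : ∀ u : ℝ, (fun g => if (l g).id = (l e).id then u else (l g).y)
      = Function.update (fun g => (l g).y) e u := by
    intro u
    funext g
    by_cases h : g = e
    · subst h; simp
    · have : (l g).id ≠ (l e).id := by
        rw [hl.id_eq, hl.id_eq]
        exact fun h' => h (Sum.inr_injective (hid h'))
      rw [if_neg this, Function.update_of_ne h]
  simp only [poly_map, Function.Embedding.coeFn_mk, hw, hi, hu]

/-- Moving `y` to 1 where the gain is nonnegative and to 0 elsewhere makes every summand of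
`objective_sub_objective` nonnegative, as `y` starts in [0, 1]. -/
theorem runRules_decideRule (hl : Consistent ident c a L l) (hid : Function.Injective ident)
    (w : ℕ) (A M N : ℝ) (hy : ∀ e, 0 ≤ (l e).y ∧ (l e).y ≤ 1) (t : ℕ)
    (hl' : l' = runRules H ident ((List.range t).map (decideRule w A M N)) l) :
    (∀ e, l' e = { l e with y := (l' e).y }) ∧ (∀ e, 0 ≤ (l' e).y ∧ (l' e).y ≤ 1) ∧
    (∀ e, (l e).chi < t → (l' e).y = 0 ∨ (l' e).y = 1) ∧
    objective H w A M N a L (fun e => ident (Sum.inr e)) (fun e => (l e).chi) (fun e => (l e).y)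
      ≤ objective H w A M N a L (fun e => ident (Sum.inr e)) (fun e => (l e).chi)
        (fun e => (l' e).y) := by
  induction t generalizing l' with
  | zero =>
    subst hl'
    exact ⟨fun e => rfl, hy, fun f hf => absurd hf (Nat.not_lt_zero _), le_rfl⟩
  | succ t ih =>
    rw [runRules_map_range_succ] at hl'
    set m := runRules H ident ((List.range t).map (decideRule w A M N)) l with hm
    obtain ⟨ih1, ihy, ih01, ihobj⟩ := ih rfl
    have hmc : Consistent ident c a L m :=
      hl.of_eq (fun e => by rw [ih1]) (fun e => by rw [ih1]) (fun e => by rw [ih1])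
        (fun e => by rw [ih1])
    have hmchi : ∀ e, (m e).chi = (l e).chi := fun e => by rw [ih1]
    set G := edgeGain H w A M N a L (fun e => ident (Sum.inr e)) (fun e => (l e).chi)
      (fun e => (m e).y) with hG
    have hstep : ∀ e, l' e = if (l e).chi = t then { m e with y := if 0 ≤ G e then 1 else 0 }
        else m e := by
      intro e
      rw [hl']
      simp only [applyRule, decideRule, hmc.gain_eq hid, hmchi, hG]
    have hyt : ∀ e, (l e).chi = t → (l' e).y = if 0 ≤ G e then 1 else 0 := by
      intro e he; rw [hstep, if_pos he]
    have hyn : ∀ e, (l e).chi ≠ t → (l' e).y = (m e).y := by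
      intro e he; rw [hstep, if_neg he]
    refine ⟨fun e => ?_, fun e => ?_, fun e he => ?_, ihobj.trans ?_⟩
    · rw [hstep]
      split_ifs
      · rw [ih1]
      · rw [ih1]
      · exact ih1 e
    · by_cases h : (l e).chi = t
      · rw [hyt e h]
        split_ifs <;> norm_num
      · rw [hyn e h]; exact ihy e
    · by_cases h : (l e).chi = t
      · rw [hyt e h]
        split_ifs <;> simp
      · rw [hyn e h]; exact ih01 e (by omega)
    · rw [← sub_nonneg, objective_sub_objective H w A M N a L _ _
        (fun e e' h => Sum.inr_injective (hid h)) t (fun e => (m e).y) (fun e => (l' e).y) hyn]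
      refine sum_nonneg fun e he => ?_
      rw [hyt e (mem_filter.1 he).2]
      have h01 := ihy e
      rw [← hG]
      split_ifs with h
      · exact mul_nonneg (by linarith [h01.2]) h
      · exact mul_nonneg_of_nonpos_of_nonpos (by linarith [h01.1]) (not_le.1 h).le

theorem monoCost_cost (H : MultiHypergraph V E) (w : ℕ) (a : E → ℝ) (L : Finset E) (κ : E → ℕ) :
    monoCost (cost H w a L) κ
      = ∑ v, ∑ f, ∑ g, if κ f = κ g then pairCost w (star H L v) a f g else 0 := by
  rw [monoCost, sum_comm (s := univ (α := V))]
  refine sum_congr rfl fun f _ => ?_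
  rw [sum_comm (s := univ (α := V))]
  refine sum_congr rfl fun g _ => ?_
  split_ifs
  · rfl
  · simp

/-- The rules of one step, in which each active hyperedge survives with probability `p`. -/
noncomputable def stepRules (w q n₁ n₂ : ℕ) (φ₁ φ₂ : ℕ → ℕ → ℕ) (p A M N : ℝ) :
    List (Rule Label) :=
  refineRules w q n₁ n₂ φ₁ φ₂ ++ (refineRules w q n₁ n₂ φ₁ φ₂ ++ (initRule p ::
    ((List.range (q * q)).map (decideRule w A M N) ++ [finishRule])))

theorem length_stepRules (w q n₁ n₂ : ℕ) (φ₁ φ₂ : ℕ → ℕ → ℕ) (p A M N : ℝ) :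
    (stepRules w q n₁ n₂ φ₁ φ₂ p A M N).length = 2 * (n₂ * n₂) + q * q + 8 := by
  simp only [stepRules, refineRules, List.length_append, List.length_cons, List.length_map,
    List.length_range, List.length_nil]
  ring

/-- Initially all couples are monochromatic, at most (w+1)w for each pair. Two refinements leave
9/q² of them, and division by w + 1 gives the error 9w/q². Refining twice by `q`, instead of once by
q², keeps the greedy loops at about q² rules instead of q⁴. -/
theorem runRules_stepRules (hl : Consistent ident c a L l) (hid : Function.Injective ident)
    (ha : ∀ e, 0 ≤ a e) {w M₀ n₁ n₂ q : ℕ} (hw : 1 ≤ w) (hn₁ : 0 < n₁) (hn₂ : 0 < n₂)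
    (hq : 0 < q)
    (φ₁ φ₂ : ℕ → ℕ → ℕ) (hφ₁ : ∀ κ k, φ₁ κ k < n₁) (hφ₂ : ∀ κ k, φ₂ κ k < n₂)
    (hcode₁ : ∀ κ < M₀, ∀ κ' < M₀, κ ≠ κ' →
        q * ((range n₁).filter (fun k => φ₁ κ k = φ₁ κ' k)).card ≤ n₁)
    (hcode₂ : ∀ κ < n₁ * n₁, ∀ κ' < n₁ * n₁, κ ≠ κ' →
        q * ((range n₂).filter (fun k => φ₂ κ k = φ₂ κ' k)).card ≤ n₂)
    (hcM : ∀ e, c (Sum.inr e) < M₀)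
    (hproper : ∀ f g, f ≠ g → (∃ v, v ∈ H.verts f ∧ v ∈ H.verts g) → c (Sum.inr f) ≠ c (Sum.inr g))
    (hchi : ∀ e, (l e).chi = 0) {p : ℝ} (hp : 0 < p) (hpw : p ^ (w + 1) = 1 / 2)
    (A M : ℝ) {N : ℝ} (hN : 0 ≤ N)
    (hl' : l' = runRules H ident (stepRules w q n₁ n₂ φ₁ φ₂ p A M N) l) :
    ∃ L' ⊆ L, Consistent ident c a L' l' ∧ (∀ e, (l' e).chi = 0) ∧
      A * p * ∑ e ∈ L, a e - ∑ v, (M * p * ∑ e ∈ star H L v, a e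
          + N / 2 * (((star H L v).card.choose w * ∑ e ∈ star H L v, a e) * (1 + 9 * w / q ^ 2)
            + ((star H L v).card - 1).choose (w - 1) * (∑ e ∈ star H L v, a e) / (w + 1)))
        ≤ A * ∑ e ∈ L', a e - ∑ v, (M * ∑ e ∈ star H L' v, a e
          + N * ((star H L' v).card.choose w * ∑ e ∈ star H L' v, a e)) := by
  rw [stepRules, runRules_append, runRules_append, runRules_cons, runRules_append] at hl'
  have hq' : (0 : ℝ) < q := by exact_mod_cast hq
  set l₁ := runRules H ident (refineRules w q n₁ n₂ φ₁ φ₂) l with hl₁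
  obtain ⟨hc₁, hb₁, hm₁⟩ := runRules_refineRules hl hid ha w hn₁ hn₂ hq φ₁ φ₂ hφ₁ hφ₂ hcode₁
    hcode₂ hcM hproper (B := 1) (fun e => by rw [hchi e]; exact Nat.one_pos) hl₁
  set l₂ := runRules H ident (refineRules w q n₁ n₂ φ₁ φ₂) l₁ with hl₂
  obtain ⟨hc₂, hb₂, hm₂⟩ := runRules_refineRules hc₁ hid ha w hn₁ hn₂ hq φ₁ φ₂ hφ₁ hφ₂ hcode₁
    hcode₂ hcM hproper hb₁ hl₂
  rw [one_mul] at hb₂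
  have hmono : monoCost (cost H w a L) (fun e => (l₂ e).chi)
      ≤ 9 / q ^ 2 * (((w : ℝ) + 1) * w
        * ∑ v, ((star H L v).card.choose w * ∑ e ∈ star H L v, a e)) := by
    have h0 : monoCost (cost H w a L) (fun e => (l e).chi)
        ≤ ((w : ℝ) + 1) * w * ∑ v, ((star H L v).card.choose w * ∑ e ∈ star H L v, a e) := by
      rw [monoCost_cost, mul_sum]
      refine sum_le_sum fun v _ => ?_
      simp only [hchi, if_true]
      exact sum_pairCost_le w _ a ha
    calc _ ≤ 3 / q * monoCost (cost H w a L) (fun e => (l₁ e).chi) := hm₂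
      _ ≤ 3 / q * (3 / q * monoCost (cost H w a L) (fun e => (l e).chi)) := by gcongr
      _ ≤ 3 / q * (3 / q * (((w : ℝ) + 1) * w
        * ∑ v, ((star H L v).card.choose w * ∑ e ∈ star H L v, a e))) := by gcongr
      _ = _ := by ring
  set l₃ := applyRule H ident (initRule p) l₂ with hl₃
  have h3 : ∀ e, l₃ e = { l₂ e with y := p } := fun e => rfl
  have hc₃ : Consistent ident c a L l₃ := hc₂.of_eq (fun e => by rw [h3]) (fun e => by rw [h3])
    (fun e => by rw [h3]) (fun e => by rw [h3])
  have hp1 : p ≤ 1 := by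
    by_contra h
    push Not at h
    have := one_lt_pow₀ h (Nat.succ_ne_zero w)
    rw [hpw] at this
    norm_num at this
  set l₄ := runRules H ident ((List.range (q * q)).map (decideRule w A M N)) l₃ with hl₄
  obtain ⟨h4, hy4, h01, hobj⟩ := runRules_decideRule hc₃ hid w A M N
    (fun e => ⟨hp.le, hp1⟩) (q * q) hl₄
  have hc₄ : Consistent ident c a L l₄ := hc₃.of_eq (fun e => by rw [h4]) (fun e => by rw [h4])
    (fun e => by rw [h4]) (fun e => by rw [h4])
  have h01' : ∀ e, (l₄ e).y = 0 ∨ (l₄ e).y = 1 := fun e => h01 e (hb₂ e)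
  set L' := L.filter (fun e => (l₄ e).y = 1) with hL'
  have hstar : ∀ v, star H L' v = (star H L v).filter (fun e => (l₄ e).y = 1) := by
    intro v
    ext e
    simp only [star, hL', mem_filter]
    tauto
  have hlin : ∀ (T : Finset E) (B : ℝ), ∑ e ∈ T, B * a e * (l₄ e).y
      = B * ∑ e ∈ T.filter (fun e => (l₄ e).y = 1), a e := by
    intro T B
    rw [mul_sum, sum_filter]
    refine sum_congr rfl fun e _ => ?_
    rcases h01' e with h | h <;> simp [h]
  refine ⟨L', filter_subset _ _, ?_, ?_, ?_⟩
  · rw [hl']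
    refine ⟨hc₄.id_eq, hc₄.color_eq, hc₄.weight_eq, fun e => ?_⟩
    simp only [runRules_cons, runRules_nil, applyRule, finishRule, Bool.and_eq_true,
      decide_eq_true_eq, hc₄.active_iff, hL', mem_filter]
  · intro e
    rw [hl']
    rfl
  · set id := fun e : E => ident (Sum.inr e)
    set chi := fun e : E => (l₃ e).chi with hchi₃
    have hend : objective H w A M N a L id chi (fun e => (l₄ e).y)
        ≤ A * ∑ e ∈ L', a e - ∑ v, (M * ∑ e ∈ star H L' v, a e
          + N * ((star H L' v).card.choose w * ∑ e ∈ star H L' v, a e)) := by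
      rw [objective, hlin L A]
      refine sub_le_sub_left (sum_le_sum fun v _ => ?_) _
      rw [hlin (star H L v) M, ← hstar]
      refine add_le_add_right (mul_le_mul_of_nonneg_left ?_ hN) _
      refine le_poly_of_zero_one w (star H L v) (star H L' v) a ha id chi _ ?_ ?_
        (fun f => (hy4 f).1)
      · rw [hstar]; exact filter_subset _ _
      · intro f hf
        rw [hstar] at hf
        exact (mem_filter.1 hf).2
    refine le_trans ?_ (hobj.trans hend)
    have hconst : ∀ v, poly w (star H L v) a id chi (fun e => (l₃ e).y)
        ≤ 1 / 2 * ((star H L v).card.choose w * (∑ e ∈ star H L v, a e)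
          + ((star H L v).card - 1).choose (w - 1) * (∑ e ∈ star H L v, a e) / (w + 1)
          + (∑ f, ∑ g, if chi f = chi g then pairCost w (star H L v) a f g else 0) / (w + 1)) :=
      fun v => poly_const_le hw _ a ha id chi hp hpw _ (fun f _ => rfl)
    have hw0 : (0 : ℝ) < (w : ℝ) + 1 := by positivity
    rw [objective]
    have e1 : ∑ e ∈ L, A * a e * (l₃ e).y = A * p * ∑ e ∈ L, a e := by
      rw [mul_sum]
      refine sum_congr rfl fun e _ => ?_
      rw [h3]; ring
    have e2 : ∀ v, ∑ e ∈ star H L v, M * a e * (l₃ e).y = M * p * ∑ e ∈ star H L v, a e := by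
      intro v
      rw [mul_sum]
      refine sum_congr rfl fun e _ => ?_
      rw [h3]; ring
    rw [e1]
    refine sub_le_sub_left ?_ _
    have hb : ∑ v, (∑ e ∈ star H L v, M * a e * (l₃ e).y
          + N * poly w (star H L v) a id chi (fun e => (l₃ e).y))
        ≤ ∑ v, (M * p * ∑ e ∈ star H L v, a e
          + N * (1 / 2 * ((star H L v).card.choose w * (∑ e ∈ star H L v, a e)
          + ((star H L v).card - 1).choose (w - 1) * (∑ e ∈ star H L v, a e) / (w + 1)
          + (∑ f, ∑ g, if chi f = chi g then pairCost w (star H L v) a f g else 0)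
            / (w + 1)))) := by
      refine sum_le_sum fun v _ => ?_
      rw [e2]
      exact add_le_add_right (mul_le_mul_of_nonneg_left (hconst v) hN) _
    refine hb.trans ?_
    have hmono' : monoCost (cost H w a L) chi / (w + 1)
        ≤ 9 * w / q ^ 2 * ∑ v, ((star H L v).card.choose w * ∑ e ∈ star H L v, a e) := by
      rw [div_le_iff₀ hw0]
      refine hmono.trans (le_of_eq ?_)
      ring
    rw [monoCost_cost] at hmono'
    have hsplit1 : ∀ v, M * p * ∑ e ∈ star H L v, a e
          + N * (1 / 2 * ((star H L v).card.choose w * (∑ e ∈ star H L v, a e)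
          + ((star H L v).card - 1).choose (w - 1) * (∑ e ∈ star H L v, a e) / (w + 1)
          + (∑ f, ∑ g, if chi f = chi g then pairCost w (star H L v) a f g else 0)
            / (w + 1)))
        = (M * p * ∑ e ∈ star H L v, a e
          + N / 2 * ((star H L v).card.choose w * (∑ e ∈ star H L v, a e)
          + ((star H L v).card - 1).choose (w - 1) * (∑ e ∈ star H L v, a e) / (w + 1)))
          + N / 2 * ((∑ f, ∑ g, if chi f = chi g then pairCost w (star H L v) a f g else 0)
            / (w + 1)) := fun v => by ring
    have hsplit2 : ∀ v, M * p * ∑ e ∈ star H L v, a e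
          + N / 2 * (((star H L v).card.choose w * ∑ e ∈ star H L v, a e) * (1 + 9 * w / q ^ 2)
            + ((star H L v).card - 1).choose (w - 1) * (∑ e ∈ star H L v, a e) / (w + 1))
        = (M * p * ∑ e ∈ star H L v, a e
          + N / 2 * ((star H L v).card.choose w * (∑ e ∈ star H L v, a e)
          + ((star H L v).card - 1).choose (w - 1) * (∑ e ∈ star H L v, a e) / (w + 1)))
          + N / 2 * (9 * w / q ^ 2 * ((star H L v).card.choose w * ∑ e ∈ star H L v, a e)) :=
      fun v => by ring
    rw [sum_congr rfl fun v _ => hsplit1 v, sum_congr rfl fun v _ => hsplit2 v]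
    simp only [sum_add_distrib]
    refine add_le_add_right ?_ _
    rw [← mul_sum, ← mul_sum, ← mul_sum, ← sum_div]
    exact mul_le_mul_of_nonneg_left hmono' (by positivity)

end Decide

end LocalRounding

namespace LocalRounding

open Finset

/-! ### The potential along the w + 1 steps of a stage. -/

section Steps

variable {V E : Type*} [Fintype V] [Fintype E] [DecidableEq V] [DecidableEq E]
  {H : MultiHypergraph V E} {ident c : V ⊕ E → ℕ} {a : E → ℝ} {L : Finset E} {l l' : E → Label}

/-- The potential after `j` steps. -/
noncomputable def stepPotential (H : MultiHypergraph V E) (w : ℕ) (p A B Q η : ℝ) (a : E → ℝ)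
    (j : ℕ) (L : Finset E) : ℝ :=
  A * p⁻¹ ^ j * ∑ e ∈ L, a e
    - B * (1 + η)⁻¹ ^ j * ∑ v, (p⁻¹ ^ j * Q + 2 ^ j * (star H L v).card.choose w)
      * ∑ e ∈ star H L v, a e

/-- The rules of the first `j` steps. -/
noncomputable def roundingRules (w q n₁ n₂ : ℕ) (φ₁ φ₂ : ℕ → ℕ → ℕ) (p A B Q η : ℝ) (j : ℕ) :
    List (Rule Label) :=
  (List.range j).flatMap fun k => stepRules w q n₁ n₂ φ₁ φ₂ p (A * p⁻¹ ^ (k + 1))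
    (B * (1 + η)⁻¹ ^ (k + 1) * (p⁻¹ ^ (k + 1) * Q)) (B * (1 + η)⁻¹ ^ (k + 1) * 2 ^ (k + 1))

theorem length_roundingRules (w q n₁ n₂ : ℕ) (φ₁ φ₂ : ℕ → ℕ → ℕ) (p A B Q η : ℝ) (j : ℕ) :
    (roundingRules w q n₁ n₂ φ₁ φ₂ p A B Q η j).length = j * (2 * (n₂ * n₂) + q * q + 8) := by
  induction j with
  | zero => simp [roundingRules]
  | succ j ih =>
    rw [roundingRules, List.range_succ, List.flatMap_append, List.length_append, ← roundingRules,
      ih]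
    simp only [List.flatMap_singleton, length_stepRules]
    ring

/-- The coefficients p^{-j} and 2^j undo the expected loss of weight and of pairs in each step, so
the potential would be preserved up to errors. The factor (1 + η)^{-j} absorbs them: one half of η
pays for monochromatic couples, and the pairs with e ∈ W are paid by the other half or by the `Q`
term. -/
theorem runRules_roundingRules (hl : Consistent ident c a L l) (hid : Function.Injective ident)
    (ha : ∀ e, 0 ≤ a e) {w M₀ n₁ n₂ q : ℕ} (hw : 1 ≤ w) (hn₁ : 0 < n₁) (hn₂ : 0 < n₂)
    (hq : 0 < q)
    (φ₁ φ₂ : ℕ → ℕ → ℕ) (hφ₁ : ∀ κ k, φ₁ κ k < n₁) (hφ₂ : ∀ κ k, φ₂ κ k < n₂)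
    (hcode₁ : ∀ κ < M₀, ∀ κ' < M₀, κ ≠ κ' →
        q * ((range n₁).filter (fun k => φ₁ κ k = φ₁ κ' k)).card ≤ n₁)
    (hcode₂ : ∀ κ < n₁ * n₁, ∀ κ' < n₁ * n₁, κ ≠ κ' →
        q * ((range n₂).filter (fun k => φ₂ κ k = φ₂ κ' k)).card ≤ n₂)
    (hcM : ∀ e, c (Sum.inr e) < M₀)
    (hproper : ∀ f g, f ≠ g → (∃ v, v ∈ H.verts f ∧ v ∈ H.verts g) → c (Sum.inr f) ≠ c (Sum.inr g))
    (hchi : ∀ e, (l e).chi = 0) {p : ℝ} (hp : 0 < p) (hpw : p ^ (w + 1) = 1 / 2)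
    (A : ℝ) {B Q η : ℝ} (hB : 0 ≤ B) (hQ : 0 ≤ Q) (hη : 0 ≤ η) (hqη : 9 * w / (q : ℝ) ^ 2 ≤ η / 2)
    (hsmall : ∀ d : ℕ, ((d - 1).choose (w - 1) : ℝ) / (w + 1) ≤ η / 2 * d.choose w ∨
      2 ^ (w + 1) * (((d - 1).choose (w - 1) : ℝ) / (w + 1)) ≤ η * Q)
    (j : ℕ) (hj : j ≤ w + 1)
    (hl' : l' = runRules H ident (roundingRules w q n₁ n₂ φ₁ φ₂ p A B Q η j) l) :
    ∃ L' ⊆ L, Consistent ident c a L' l' ∧ (∀ e, (l' e).chi = 0) ∧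
      stepPotential H w p A B Q η a 0 L ≤ stepPotential H w p A B Q η a j L' := by
  induction j generalizing l' with
  | zero => subst hl'; exact ⟨L, Subset.rfl, hl, hchi, le_rfl⟩
  | succ j ih =>
    rw [roundingRules, runRules_flatMap_range_succ, ← roundingRules] at hl'
    obtain ⟨L₁, hL₁, hc₁, hchi₁, hpot₁⟩ := ih (by omega) rfl
    have hη1 : (0 : ℝ) < 1 + η := by linarith
    obtain ⟨L', hL', hc', hchi', hpot'⟩ := runRules_stepRules hc₁ hid ha hw hn₁ hn₂ hq φ₁ φ₂ hφ₁
      hφ₂ hcode₁ hcode₂ hcM hproper hchi₁ hp hpw (A * p⁻¹ ^ (j + 1))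
      (B * (1 + η)⁻¹ ^ (j + 1) * (p⁻¹ ^ (j + 1) * Q))
      (N := B * (1 + η)⁻¹ ^ (j + 1) * 2 ^ (j + 1)) (by positivity) hl'
    refine ⟨L', hL'.trans hL₁, hc', hchi', hpot₁.trans ?_⟩
    have hp1 : 1 ≤ p⁻¹ := by
      rw [one_le_inv₀ hp]
      by_contra h
      push Not at h
      have := one_lt_pow₀ h (Nat.succ_ne_zero w)
      rw [hpw] at this
      norm_num at this
    have hpp : p⁻¹ ^ (j + 1) * p = p⁻¹ ^ j := by
      rw [pow_succ, mul_assoc, inv_mul_cancel₀ hp.ne', mul_one]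
    have hηη : (1 + η)⁻¹ ^ (j + 1) * (1 + η) = (1 + η)⁻¹ ^ j := by
      rw [pow_succ, mul_assoc, inv_mul_cancel₀ hη1.ne', mul_one]
    have hend : A * p⁻¹ ^ (j + 1) * ∑ e ∈ L', a e
        - ∑ v, (B * (1 + η)⁻¹ ^ (j + 1) * (p⁻¹ ^ (j + 1) * Q) * ∑ e ∈ star H L' v, a e
          + B * (1 + η)⁻¹ ^ (j + 1) * 2 ^ (j + 1)
            * ((star H L' v).card.choose w * ∑ e ∈ star H L' v, a e))
        = stepPotential H w p A B Q η a (j + 1) L' := by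
      rw [stepPotential]
      congr 1
      rw [mul_sum]
      refine sum_congr rfl fun v _ => ?_
      ring
    rw [← hend]
    refine le_trans ?_ hpot'
    rw [stepPotential, mul_assoc A, mul_assoc A (p⁻¹ ^ (j + 1)) p, hpp, mul_assoc A]
    refine sub_le_sub_left ?_ _
    rw [mul_sum]
    refine sum_le_sum fun v _ => ?_
    set d := (star H L₁ v).card
    set u := ∑ e ∈ star H L₁ v, a e
    have hu : 0 ≤ u := sum_nonneg fun e _ => ha e
    have hkey : p⁻¹ ^ j * Q + 2 ^ j * (d.choose w * (1 + 9 * w / (q : ℝ) ^ 2)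
        + ((d - 1).choose (w - 1) : ℝ) / (w + 1))
        ≤ (1 + η) * (p⁻¹ ^ j * Q + 2 ^ j * d.choose w) := by
      have h2j : (2 : ℝ) ^ j ≤ 2 ^ (w + 1) := pow_le_pow_right₀ (by norm_num) (by omega)
      have hpj : 1 ≤ p⁻¹ ^ j := one_le_pow₀ hp1
      have hcd : (0 : ℝ) ≤ d.choose w := Nat.cast_nonneg _
      have hcd' : (0 : ℝ) ≤ ((d - 1).choose (w - 1) : ℝ) / (w + 1) := by positivity
      have h1 : (2 : ℝ) ^ j * (d.choose w * (9 * w / (q : ℝ) ^ 2))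
          ≤ 2 ^ j * (d.choose w * (η / 2)) := by gcongr
      -- The power 2^{w+1} in the second alternative of `hsmall` serves all steps, since 2^j ≤
      -- 2^{w+1} and p^{-j} ≥ 1.
      have h2 : (2 : ℝ) ^ j * (((d - 1).choose (w - 1) : ℝ) / (w + 1))
          ≤ η * (p⁻¹ ^ j * Q) + 2 ^ j * (d.choose w * (η / 2)) := by
        rcases hsmall d with h | h
        · have h3 : (2 : ℝ) ^ j * (((d - 1).choose (w - 1) : ℝ) / (w + 1))
            ≤ 2 ^ j * (η / 2 * d.choose w) := by gcongr
          have h4 : 0 ≤ η * (p⁻¹ ^ j * Q) := by positivity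
          linarith
        · have h3 : (2 : ℝ) ^ j * (((d - 1).choose (w - 1) : ℝ) / (w + 1))
            ≤ 2 ^ (w + 1) * (((d - 1).choose (w - 1) : ℝ) / (w + 1)) := by gcongr
          have h4 : η * Q ≤ η * (p⁻¹ ^ j * Q) := by
            gcongr
            exact le_mul_of_one_le_left hQ hpj
          have h5 : 0 ≤ (2 : ℝ) ^ j * (d.choose w * (η / 2)) := by positivity
          linarith
      linarith
    have hkey' := mul_le_mul_of_nonneg_left (mul_le_mul_of_nonneg_right hkey hu)
      (by positivity : 0 ≤ B * (1 + η)⁻¹ ^ (j + 1))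
    calc _ = B * (1 + η)⁻¹ ^ (j + 1) * ((p⁻¹ ^ (j + 1) * p * Q
          + 2 ^ j * (d.choose w * (1 + 9 * w / (q : ℝ) ^ 2)
        + ((d - 1).choose (w - 1) : ℝ) / (w + 1))) * u) := by
          rw [pow_succ 2 j]
          ring
      _ ≤ _ := by
          rw [hpp]
          refine hkey'.trans (le_of_eq ?_)
          rw [← hηη]
          ring

end Steps

/-! ### Estimates for binomial coefficients and for the parameters. -/

section Numeric

theorem ring_choose_eq_prod (y : ℝ) (w : ℕ) :
    Ring.choose y w = (∏ k ∈ range w, (y - k)) / (w.factorial : ℝ) := by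
  rw [Ring.choose_eq_smul, ← Polynomial.aeval_eq_smeval, Polynomial.aeval_def,
    ← Polynomial.eval_map, descPochhammer_map, descPochhammer_eval_eq_prod_range, smul_eq_mul, inv_mul_eq_div]

theorem ring_choose_nonneg {y : ℝ} {w : ℕ} (hy : (w : ℝ) ≤ y + 1) : 0 ≤ Ring.choose y w := by
  rw [ring_choose_eq_prod]
  refine div_nonneg (prod_nonneg fun k hk => ?_) (by positivity)
  have : ((k + 1 : ℕ) : ℝ) ≤ w := by exact_mod_cast mem_range.1 hk
  push_cast at this
  linarith

/-- Factor by factor, y' - k ≤ (y'/y)(y - k) because y' ≤ y; the first hypothesis keeps all factors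
on the left nonnegative. -/
theorem ring_choose_le {y y' : ℝ} {w : ℕ} (hy : (w : ℝ) ≤ y' + 1) (h : y' ≤ y) (h0 : 0 < y) :
    Ring.choose y' w ≤ (y' / y) ^ w * Ring.choose y w := by
  rw [ring_choose_eq_prod, ring_choose_eq_prod, ← mul_div_assoc]
  refine div_le_div_of_nonneg_right ?_ (by positivity)
  have hcard : (y' / y) ^ w = ∏ _k ∈ range w, (y' / y) := by rw [prod_const, card_range]
  rw [hcard, ← prod_mul_distrib]
  refine prod_le_prod (fun k hk => ?_) (fun k hk => ?_)
  · have : ((k + 1 : ℕ) : ℝ) ≤ w := by exact_mod_cast mem_range.1 hk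
    push_cast at this
    linarith
  · rw [div_mul_eq_mul_div, le_div_iff₀ h0]
    have : (0 : ℝ) ≤ (k : ℝ) * (y - y') := mul_nonneg (Nat.cast_nonneg k) (by linarith)
    linarith

open Rounding

variable {r Δ i : ℕ}

/-- For Δ ≤ 1 the conventions for division by zero and for the logarithm of zero give s = 0. -/
theorem two_le_of_lt_s (hi : (i : ℤ) < s r Δ) : 2 ≤ Δ := by
  by_contra h
  have hpos : 0 < s r Δ := by omega
  have h01 : Δ = 0 ∨ Δ = 1 := by omega
  rcases h01 with rfl | rfl <;> simp [s, w] at hpos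

theorem one_le_logb_two (hΔ : 2 ≤ Δ) : 1 ≤ Real.logb 2 (Δ : ℝ) := by
  rw [Real.le_logb_iff_rpow_le (by norm_num) (by positivity), Real.rpow_one]
  exact_mod_cast hΔ

theorem two_le_w (hr : 2 ≤ r) (hΔ : 2 ≤ Δ) : 2 ≤ w r Δ := by
  have h1 := one_le_logb_two hΔ
  have hr' : (2 : ℝ) ≤ r := by exact_mod_cast hr
  have h2 : (2 : ℝ) ≤ r * Real.logb 2 Δ := by nlinarith
  have h3 : 1 ≤ Real.logb 2 ((r : ℝ) * Real.logb 2 Δ) := by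
    rw [Real.le_logb_iff_rpow_le (by norm_num) (by linarith), Real.rpow_one]
    exact h2
  have h4 : (2 : ℝ) ≤ w r Δ := le_trans (by linarith) (Nat.le_ceil _)
  exact_mod_cast h4

/-- The threshold `w⁴ log¹⁰ (r Δ)` below which the degrees do not drop. -/
noncomputable def threshold (r Δ : ℕ) : ℝ :=
  (w r Δ : ℝ) ^ 4 * Real.log ((r : ℝ) * (Δ : ℝ)) ^ 10

theorem one_le_log (hr : 2 ≤ r) (hΔ : 2 ≤ Δ) : 1 ≤ Real.log ((r : ℝ) * Δ) := by
  have hr' : (2 : ℝ) ≤ r := by exact_mod_cast hr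
  have hΔ' : (2 : ℝ) ≤ Δ := by exact_mod_cast hΔ
  have h4 : (4 : ℝ) ≤ r * Δ := by nlinarith
  have h : Real.log 4 ≤ Real.log ((r : ℝ) * Δ) := Real.log_le_log (by norm_num) h4
  have h2 : Real.log 4 = 2 * Real.log 2 := by
    rw [show (4 : ℝ) = 2 ^ 2 by norm_num, Real.log_pow]; norm_num
  have := Real.log_two_gt_d9
  linarith

theorem sixteen_le_threshold (hr : 2 ≤ r) (hΔ : 2 ≤ Δ) : 16 ≤ threshold r Δ := by
  have hw : (2 : ℝ) ≤ w r Δ := by exact_mod_cast two_le_w hr hΔ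
  have h1 : (2 : ℝ) ^ 4 ≤ (w r Δ : ℝ) ^ 4 := by gcongr
  have h2 : 1 ≤ Real.log ((r : ℝ) * Δ) ^ 10 := one_le_pow₀ (one_le_log hr hΔ)
  rw [threshold]
  nlinarith

/-- An integer below a ceiling is below the number itself, so every stage starts with Δ2^{-i}
strictly above the threshold. -/
theorem threshold_lt (hr : 2 ≤ r) (hi : (i : ℤ) < s r Δ) :
    threshold r Δ < (Δ : ℝ) * (2 : ℝ) ^ (-(i : ℤ)) := by
  have hΔ := two_le_of_lt_s hi
  have hth := sixteen_le_threshold hr hΔ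
  have hΔ' : (0 : ℝ) < Δ := by positivity
  have h1 : (i : ℝ) < Real.logb 2 ((Δ : ℝ) / threshold r Δ) := by
    have := Int.lt_ceil.1 (show (i : ℤ) < ⌈Real.logb 2 ((Δ : ℝ) / threshold r Δ)⌉ from hi)
    exact_mod_cast this
  rw [Real.lt_logb_iff_rpow_lt (by norm_num) (by positivity), Real.rpow_natCast,
    lt_div_iff₀ (by linarith)] at h1
  rw [zpow_neg, zpow_natCast, ← div_eq_mul_inv, lt_div_iff₀ (by positivity)]
  linarith

theorem three_le_log (hr : 2 ≤ r) (hi : (i : ℤ) < s r Δ) : 3 ≤ Real.log ((r : ℝ) * Δ) := by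
  have hΔ := two_le_of_lt_s hi
  have h0 : ((0 : ℕ) : ℤ) < s r Δ := by push_cast; omega
  have h1 := threshold_lt hr h0
  have h2 := sixteen_le_threshold hr hΔ
  simp only [Nat.cast_zero, neg_zero, zpow_zero, mul_one] at h1
  have hr' : (2 : ℝ) ≤ r := by exact_mod_cast hr
  have h32 : (32 : ℝ) ≤ r * Δ := by nlinarith
  have h : Real.log 32 ≤ Real.log ((r : ℝ) * Δ) := Real.log_le_log (by norm_num) h32
  have h3 : Real.log 32 = 5 * Real.log 2 := by
    rw [show (32 : ℝ) = 2 ^ 5 by norm_num, Real.log_pow]; norm_num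
  have := Real.log_two_gt_d9
  linarith

theorem logb_two_le {z : ℝ} (hz : 1 ≤ z) : Real.logb 2 z ≤ 3 / 2 * Real.log z := by
  have h := Real.log_nonneg hz
  have := Real.log_two_gt_d9
  rw [Real.logb, div_le_iff₀ (by linarith)]
  nlinarith

theorem s_le_log (hr : 2 ≤ r) (hi : (i : ℤ) < s r Δ) : (s r Δ : ℝ) ≤ 3 / 2 * Real.log Δ := by
  have hΔ := two_le_of_lt_s hi
  have hΔ' : (1 : ℝ) ≤ Δ := by exact_mod_cast (by omega : 1 ≤ Δ)
  have hth := sixteen_le_threshold hr hΔ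
  have h1 : (s r Δ : ℝ) < Real.logb 2 ((Δ : ℝ) / threshold r Δ) + 1 := Int.ceil_lt_add_one _
  rw [Real.logb_div (by positivity) (by positivity)] at h1
  have h2 : 1 ≤ Real.logb 2 (threshold r Δ) := by
    rw [Real.le_logb_iff_rpow_le (by norm_num) (by linarith), Real.rpow_one]
    linarith
  have h3 := logb_two_le hΔ'
  linarith

/-- Since binom(d-1, w-1) = (w/d) binom(d, w), the first alternative holds as soon as d ≥ 4sw.
Otherwise d is far below D = Δ2^{-i}, which exceeds w⁴ log¹⁰(rΔ), and binom(d, w) ≤ (d/D)^w binom(D,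
w) is small enough even after multiplication by 2^{w+1} · 2s. -/
theorem choose_pred_small (hr : 2 ≤ r) (hi : (i : ℤ) < s r Δ) (d : ℕ) :
    ((d - 1).choose (w r Δ - 1) : ℝ) / (w r Δ + 1)
        ≤ 1 / (2 * s r Δ * (w r Δ + 1)) / 2 * d.choose (w r Δ) ∨
      2 ^ (w r Δ + 1) * (((d - 1).choose (w r Δ - 1) : ℝ) / (w r Δ + 1))
        ≤ 1 / (2 * s r Δ * (w r Δ + 1)) * Ring.choose ((Δ : ℝ) * (2 : ℝ) ^ (-(i : ℤ))) (w r Δ) := by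
  have hΔ := two_le_of_lt_s hi
  have hw2 := two_le_w hr hΔ
  have hs1 : (1 : ℝ) ≤ s r Δ := by exact_mod_cast (by omega : (1 : ℤ) ≤ s r Δ)
  have hth := threshold_lt hr hi
  have hlam := three_le_log hr hi
  have hΔ' : (1 : ℝ) ≤ Δ := by exact_mod_cast (by omega : 1 ≤ Δ)
  have hr' : (1 : ℝ) ≤ r := by exact_mod_cast (by omega : 1 ≤ r)
  have hs := s_le_log hr hi
  have hlog : Real.log Δ ≤ Real.log ((r : ℝ) * Δ) :=
    Real.log_le_log (by linarith) (by nlinarith)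
  set D := (Δ : ℝ) * (2 : ℝ) ^ (-(i : ℤ))
  set lam := Real.log ((r : ℝ) * Δ)
  set σ : ℝ := (s r Δ : ℝ)
  rw [threshold] at hth
  set W := w r Δ
  have hW : (2 : ℝ) ≤ W := by exact_mod_cast hw2
  have hW0 : (0 : ℝ) < (W : ℝ) + 1 := by linarith
  -- The constant comes from w ≥ 2 and log(rΔ) ≥ 3, as 2² · 3⁸ = 26244.
  have hDW : 20000 * (W * lam) ^ 2 ≤ D := by
    have h1 : (2 : ℝ) ^ 2 * 3 ^ 8 ≤ (W : ℝ) ^ 2 * lam ^ 8 := by gcongr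
    calc 20000 * (W * lam) ^ 2 ≤ (W : ℝ) ^ 2 * lam ^ 8 * (W * lam) ^ 2 := by
          gcongr; norm_num at h1; linarith
      _ = (W : ℝ) ^ 4 * lam ^ 10 := by ring
      _ ≤ D := hth.le
  have hWl : 6 ≤ W * lam := by nlinarith
  have hσW : σ * W ≤ 3 / 2 * (W * lam) := by nlinarith
  have hD0 : 0 < D := by nlinarith
  have hWle : (W : ℝ) ≤ W * lam := by nlinarith
  have hWD : (W : ℝ) ≤ D := by nlinarith
  by_cases hd : 4 * σ * W ≤ d
  · left
    have hd0 : 0 < d := by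
      have : (0 : ℝ) < d := by nlinarith
      exact_mod_cast this
    have hid : (d : ℝ) * (d - 1).choose (W - 1) = d.choose W * W := by
      have := Nat.add_one_mul_choose_eq (d - 1) (W - 1)
      rw [Nat.sub_add_cancel hd0, Nat.sub_add_cancel (by omega : 1 ≤ W)] at this
      exact_mod_cast this
    have hc : (0 : ℝ) ≤ (d - 1).choose (W - 1) := Nat.cast_nonneg _
    have h1 : 4 * σ * W * (d - 1).choose (W - 1) ≤ d.choose W * W := by
      rw [← hid]; gcongr
    have h2 : 4 * σ * (d - 1).choose (W - 1) ≤ d.choose W := by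
      have : 4 * σ * (d - 1).choose (W - 1) * W ≤ d.choose W * W := by linarith
      exact le_of_mul_le_mul_right this (by linarith)
    rw [div_le_iff₀ hW0]
    have h3 : 1 / (2 * σ * (W + 1)) / 2 * (d.choose W : ℝ) * (W + 1) = d.choose W / (4 * σ) := by
      field_simp; ring
    rw [h3, le_div_iff₀ (by linarith)]
    linarith
  · right
    push Not at hd
    have hc : ((d - 1).choose (W - 1) : ℝ) ≤ d.choose W := by
      rcases Nat.eq_zero_or_pos d with h | h
      · subst h
        rw [Nat.choose_eq_zero_of_lt (by omega)]
        simp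
      · have := Nat.choose_succ_succ (d - 1) (W - 1)
        rw [Nat.succ_eq_add_one, Nat.succ_eq_add_one, Nat.sub_add_cancel h,
          Nat.sub_add_cancel (by omega : 1 ≤ W)] at this
        exact_mod_cast (by omega : (d - 1).choose (W - 1) ≤ d.choose W)
    have hmain : 2 ^ (W + 1) * (d.choose W : ℝ) * (2 * σ) ≤ Ring.choose D W := by
      have hQ : 0 ≤ Ring.choose D W := ring_choose_nonneg (by linarith)
      by_cases hdW : d < W
      · rw [Nat.choose_eq_zero_of_lt hdW]
        simpa using hQ
      · push Not at hdW
        have hdW' : (W : ℝ) ≤ d := by exact_mod_cast hdW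
        have hdD : (2 * d : ℝ) ≤ D := by nlinarith
        have h1 : (d.choose W : ℝ) ≤ (d / D) ^ W * Ring.choose D W := by
          have := ring_choose_le (y := D) (y' := d) (w := W) (by linarith) (by linarith) hD0
          rwa [Ring.choose_natCast] at this
        have h2 : 2 * d / D ≤ 1 := by rw [div_le_one hD0]; exact hdD
        have h3 : (2 * d / D) ^ W ≤ (2 * d / D) ^ 2 :=
          pow_le_pow_of_le_one (by positivity) h2 hw2
        have h4 : 4 * σ * (2 * d / D) ^ 2 ≤ 1 := by
          rw [div_pow, ← mul_div_assoc, div_le_one (by positivity)]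
          have hd2 : (2 * (d : ℝ)) ^ 2 ≤ (12 * (W * lam)) ^ 2 := by
            refine pow_le_pow_left₀ (by positivity) ?_ 2
            linarith
          have hσ2 : 4 * σ ≤ 6 * (W * lam) := by nlinarith
          calc 4 * σ * (2 * (d : ℝ)) ^ 2 ≤ 6 * (W * lam) * (12 * (W * lam)) ^ 2 := by gcongr
            _ = 864 * (W * lam) ^ 3 := by ring
            _ ≤ (20000 * (W * lam) ^ 2) ^ 2 := by
              have : (0 : ℝ) ≤ (W * lam) ^ 3 := by positivity
              nlinarith
            _ ≤ D ^ 2 := by gcongr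
        calc 2 ^ (W + 1) * (d.choose W : ℝ) * (2 * σ)
            ≤ 2 ^ (W + 1) * ((d / D) ^ W * Ring.choose D W) * (2 * σ) := by gcongr
          _ = 4 * σ * (2 * d / D) ^ W * Ring.choose D W := by
              rw [show 2 * (d : ℝ) / D = 2 * (d / D) by ring, mul_pow, pow_succ]; ring
          _ ≤ 4 * σ * (2 * d / D) ^ 2 * Ring.choose D W := by gcongr
          _ ≤ 1 * Ring.choose D W := by gcongr
          _ = _ := one_mul _
    rw [div_mul_eq_mul_div, one_mul, le_div_iff₀ (by positivity)]
    calc 2 ^ (W + 1) * (((d - 1).choose (W - 1) : ℝ) / (W + 1)) * (2 * σ * (W + 1))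
        = 2 ^ (W + 1) * ((d - 1).choose (W - 1) : ℝ) * (2 * σ) := by field_simp
      _ ≤ 2 ^ (W + 1) * (d.choose W : ℝ) * (2 * σ) := by gcongr
      _ ≤ _ := hmain

/-- The left side is at most exp(1/(2s)), and 1/2 ≤ log 2. The slack α of one stage thus pays for
all its steps. -/
theorem one_add_pow_le_α (hi : (i : ℤ) < s r Δ) :
    (1 + 1 / (2 * s r Δ * ((w r Δ : ℝ) + 1))) ^ (w r Δ + 1) ≤ α r Δ := by
  have hs1 : (1 : ℝ) ≤ s r Δ := by exact_mod_cast (by omega : (1 : ℤ) ≤ s r Δ)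
  set σ : ℝ := (s r Δ : ℝ) with hσ
  set η := 1 / (2 * σ * ((w r Δ : ℝ) + 1)) with hη
  have hη0 : 0 ≤ η := by positivity
  calc (1 + η) ^ (w r Δ + 1) ≤ Real.exp η ^ (w r Δ + 1) := by
        gcongr
        rw [add_comm]; exact Real.add_one_le_exp η
    _ = Real.exp (1 / (2 * σ)) := by
        rw [← Real.exp_nat_mul]
        congr 1
        rw [hη]; push_cast; field_simp
    _ ≤ Real.exp (Real.log 2 * (1 / σ)) := by
        have := Real.log_two_gt_d9
        rw [Real.exp_le_exp]
        have h1 : 1 / (2 * σ) = 1 / 2 * (1 / σ) := by field_simp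
        rw [h1]
        have : 0 ≤ 1 / σ := by positivity
        nlinarith
    _ = α r Δ := by
        rw [α, Real.rpow_def_of_pos (by norm_num)]

theorem one_le_α (hi : (i : ℤ) < s r Δ) : 1 ≤ α r Δ := by
  have hs1 : (1 : ℝ) ≤ s r Δ := by exact_mod_cast (by omega : (1 : ℤ) ≤ s r Δ)
  exact Real.one_le_rpow (by norm_num) (by positivity)

end Numeric

end LocalRounding

/-! ### Choice of the codes and the round bound. -/

namespace LocalRounding

open Finset Rounding

theorem clog_two_le {n : ℕ} (hn : 1 ≤ n) : (Nat.clog 2 n : ℝ) ≤ 3 / 2 * Real.log n + 1 := by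
  have hn' : (1 : ℝ) ≤ n := by exact_mod_cast hn
  rcases Nat.lt_or_ge 1 n with h | h
  · have h1 : 2 ^ (Nat.clog 2 n).pred < n := Nat.pow_pred_clog_lt_self (by norm_num) h
    have h2 : ((Nat.clog 2 n).pred : ℝ) ≤ Real.logb 2 n := by
      rw [Real.le_logb_iff_rpow_le (by norm_num) (by linarith), Real.rpow_natCast]
      exact_mod_cast h1.le
    have h3 : (Nat.clog 2 n : ℝ) ≤ (Nat.clog 2 n).pred + 1 := by
      exact_mod_cast (by rw [Nat.pred_eq_sub_one]; omega :
        Nat.clog 2 n ≤ (Nat.clog 2 n).pred + 1)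
    linarith [logb_two_le hn']
  · have : n = 1 := by omega
    subst this
    simp

theorem w_le {r Δ : ℕ} (hr : 2 ≤ r) (hΔ : 2 ≤ Δ) :
    (w r Δ : ℝ) ≤ 9 * Real.log ((r : ℝ) + Real.log Δ) + 1 := by
  have hr' : (2 : ℝ) ≤ r := by exact_mod_cast hr
  have hΔ' : (1 : ℝ) ≤ Δ := by exact_mod_cast (by omega : 1 ≤ Δ)
  have hlog := Real.log_nonneg hΔ'
  set y := (r : ℝ) + Real.log Δ with hy
  have hy2 : 2 ≤ y := by linarith
  have h1 := one_le_logb_two hΔ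
  have hz1 : 1 ≤ (r : ℝ) * Real.logb 2 Δ := by nlinarith
  have hz : (r : ℝ) * Real.logb 2 Δ ≤ y ^ 3 := by
    have h2 : Real.logb 2 Δ ≤ 2 * y := by linarith [logb_two_le hΔ']
    calc (r : ℝ) * Real.logb 2 Δ ≤ y * (2 * y) := by
          gcongr; linarith
      _ ≤ y * (y * y) := by gcongr
      _ = y ^ 3 := by ring
  have h3 : Real.logb 2 ((r : ℝ) * Real.logb 2 Δ) ≤ 9 / 2 * Real.log y := by
    have h4 := logb_two_le hz1
    have h5 := Real.log_le_log (by linarith) hz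
    rw [Real.log_pow] at h5
    push_cast at h5
    linarith
  have h6 : 0 ≤ Real.logb 2 ((r : ℝ) * Real.logb 2 Δ) := Real.logb_nonneg (by norm_num) hz1
  have h7 := Nat.ceil_lt_add_one (by linarith : 0 ≤ 2 * Real.logb 2 ((r : ℝ) * Real.logb 2 Δ))
  rw [w]
  linarith

/-- With y = r + log Δ and Λ = 1 + log y one has w = O(Λ), s = O(y) and q² = O(Λ²y). The first code
has length n₁ polynomial in y, so the second has length n₂ = O(qΛ). The greedy loops then take
O(q²Λ²) rules per step, and there are w + 1 steps. -/
theorem exists_parameters (K : ℕ) : ∃ C : ℕ, ∀ r Δ i : ℕ, 2 ≤ r → (i : ℤ) < s r Δ →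
    ∃ (q n₁ n₂ : ℕ) (φ₁ φ₂ : ℕ → ℕ → ℕ), 0 < q ∧ 0 < n₁ ∧ 0 < n₂ ∧
      (∀ κ k, φ₁ κ k < n₁) ∧ (∀ κ k, φ₂ κ k < n₂) ∧
      (∀ κ < K * (r * Δ) ^ K, ∀ κ' < K * (r * Δ) ^ K, κ ≠ κ' →
        q * ((range n₁).filter (fun k => φ₁ κ k = φ₁ κ' k)).card ≤ n₁) ∧
      (∀ κ < n₁ * n₁, ∀ κ' < n₁ * n₁, κ ≠ κ' →
        q * ((range n₂).filter (fun k => φ₂ κ k = φ₂ κ' k)).card ≤ n₂) ∧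
      9 * (w r Δ : ℝ) / (q : ℝ) ^ 2 ≤ 1 / (2 * s r Δ * ((w r Δ : ℝ) + 1)) / 2 ∧
      ((2 * ((w r Δ + 1) * (2 * (n₂ * n₂) + q * q + 8)) : ℕ) : ℝ)
        ≤ C * (((r : ℝ) + Real.log Δ) * (1 + Real.log ((r : ℝ) + Real.log Δ)) ^ C) := by
  obtain ⟨c₂, hc₂⟩ : ∃ c₂ : ℕ, c₂ = 38880 * (3 * K + 1) := ⟨_, rfl⟩
  obtain ⟨c₃, hc₃⟩ : ∃ c₃ : ℕ, c₃ = 3 * c₂ + 15 := ⟨_, rfl⟩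
  obtain ⟨C, hC⟩ : ∃ C : ℕ, C = 20 * (155520 * c₃ ^ 2 + 19448) := ⟨_, rfl⟩
  refine ⟨C, fun r Δ i hr hi => ?_⟩
  have hΔ := two_le_of_lt_s hi
  have hw2 := two_le_w hr hΔ
  have hwle := w_le hr hΔ
  have hr' : (2 : ℝ) ≤ r := by exact_mod_cast hr
  have hΔ1 : (1 : ℝ) ≤ Δ := by exact_mod_cast (by omega : 1 ≤ Δ)
  have hlogΔ := Real.log_nonneg hΔ1
  have hsle := s_le_log hr hi
  set W := w r Δ
  set y := (r : ℝ) + Real.log Δ with hy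
  have hy2 : 2 ≤ y := by linarith
  have hlogy : 0 ≤ Real.log y := Real.log_nonneg (by linarith)
  set Λ := 1 + Real.log y with hΛ
  have hΛ1 : 1 ≤ Λ := by linarith
  have hΛy : Λ ≤ y := by have := Real.log_le_sub_one_of_pos (by linarith : 0 < y); linarith
  have hW : (W : ℝ) ≤ 9 * Λ := by linarith
  have hW' : (W : ℝ) + 1 ≤ 10 * Λ := by linarith
  set σ := (s r Δ).toNat with hσ
  have hσs : (σ : ℤ) = s r Δ := Int.toNat_of_nonneg (by omega)
  have hσs' : (σ : ℝ) = s r Δ := by exact_mod_cast hσs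
  have hσ1 : 1 ≤ σ := by omega
  have hσy : (σ : ℝ) ≤ 3 / 2 * y := by rw [hσs']; linarith
  -- The required bound 9w/q² ≤ 1/(4s(w+1)) is equivalent to q² ≥ n.
  set n := 36 * W * (W + 1) * σ with hn
  have hn1 : 1 ≤ n := Nat.succ_le_of_lt (by positivity)
  set q := Nat.sqrt n + 1 with hq
  have hq0 : 0 < q := Nat.succ_pos _
  have hnq : n ≤ q * q := (Nat.lt_succ_sqrt n).le
  have hqn : q * q ≤ 4 * n := by
    have h1 : 1 ≤ Nat.sqrt n := Nat.sqrt_pos.2 hn1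
    have h2 := Nat.sqrt_le n
    calc q * q ≤ (2 * Nat.sqrt n) * (2 * Nat.sqrt n) := Nat.mul_le_mul (by omega) (by omega)
      _ = 4 * (Nat.sqrt n * Nat.sqrt n) := by ring
      _ ≤ 4 * n := Nat.mul_le_mul_left 4 h2
  have hqq : (q : ℝ) * q ≤ 19440 * (Λ ^ 2 * y) := by
    calc (q : ℝ) * q ≤ 4 * (36 * W * (W + 1) * σ) := by exact_mod_cast hqn
      _ ≤ 4 * (36 * (9 * Λ) * (10 * Λ) * (3 / 2 * y)) := by gcongr
      _ = _ := by ring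
  have hq1 : (1 : ℝ) ≤ q := by exact_mod_cast hq0
  have hqle : (q : ℝ) ≤ 19440 * (Λ ^ 2 * y) := by nlinarith
  -- The logarithm of the palette size; bounding `r` by 2^r is crude but stays within O(y).
  set t₁ := K * (1 + r + Nat.clog 2 Δ) + 1 with ht₁
  have hM : K * (r * Δ) ^ K ≤ 2 ^ t₁ := by
    have h1 : r * Δ ≤ 2 ^ (r + Nat.clog 2 Δ) := by
      rw [pow_add]
      exact Nat.mul_le_mul Nat.lt_two_pow_self.le (Nat.le_pow_clog (by norm_num) Δ)
    calc K * (r * Δ) ^ K ≤ 2 ^ K * (2 ^ (r + Nat.clog 2 Δ)) ^ K :=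
          Nat.mul_le_mul Nat.lt_two_pow_self.le (Nat.pow_le_pow_left h1 K)
      _ = 2 ^ (K * (1 + r + Nat.clog 2 Δ)) := by
          rw [← pow_mul, ← pow_add]; congr 1; ring
      _ ≤ 2 ^ t₁ := Nat.pow_le_pow_right (by norm_num) (Nat.le_succ _)
  have ht₁y : (t₁ : ℝ) ≤ (3 * K + 1) * y := by
    have h1 := clog_two_le (by omega : 1 ≤ Δ)
    have hK : (0 : ℝ) ≤ K := Nat.cast_nonneg K
    have h2 : (1 : ℝ) + r + Nat.clog 2 Δ ≤ 3 * y := by linarith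
    calc (t₁ : ℝ) = K * (1 + r + Nat.clog 2 Δ) + 1 := by rw [ht₁]; push_cast; ring
      _ ≤ K * (3 * y) + y := by gcongr; linarith
      _ = _ := by ring
  obtain ⟨n₁, hlt₁, hle₁, φ₁, hφ₁, hcode₁⟩ := exists_code _ t₁ q hM (Nat.le_add_left 1 _) hq0
  have hn₁0 : 0 < n₁ := by omega
  set t₂ := 2 * Nat.clog 2 n₁ + 1 with ht₂
  have hM₂ : n₁ * n₁ ≤ 2 ^ t₂ := by
    have h1 := Nat.le_pow_clog (by norm_num : 1 < 2) n₁
    calc n₁ * n₁ ≤ 2 ^ Nat.clog 2 n₁ * 2 ^ Nat.clog 2 n₁ := Nat.mul_le_mul h1 h1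
      _ = 2 ^ (2 * Nat.clog 2 n₁) := by rw [← pow_add]; congr 1; ring
      _ ≤ 2 ^ t₂ := Nat.pow_le_pow_right (by norm_num) (Nat.le_succ _)
  have hn₁y : (n₁ : ℝ) ≤ c₂ * y ^ 4 := by
    calc (n₁ : ℝ) ≤ 2 * (q * t₁) := by exact_mod_cast hle₁
      _ ≤ 2 * (19440 * (Λ ^ 2 * y) * ((3 * K + 1) * y)) := by gcongr
      _ ≤ 2 * (19440 * (y ^ 2 * y) * ((3 * K + 1) * y)) := by gcongr
      _ = c₂ * y ^ 4 := by rw [hc₂]; push_cast; ring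
  have hc₂1 : (1 : ℝ) ≤ c₂ := by exact_mod_cast (by omega : 1 ≤ c₂)
  have ht₂Λ : (t₂ : ℝ) ≤ c₃ * Λ := by
    have h1 := clog_two_le hn₁0
    have h2 : Real.log n₁ ≤ c₂ + 4 * Real.log y := by
      have h3 := Real.log_le_log (by exact_mod_cast hn₁0) hn₁y
      rw [Real.log_mul (by positivity) (by positivity), Real.log_pow] at h3
      have h4 := Real.log_le_self (by linarith : (0 : ℝ) ≤ c₂)
      push_cast at h3
      linarith
    have h5 : (c₂ : ℝ) ≤ c₂ * Λ := le_mul_of_one_le_right (by linarith) hΛ1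
    have h6 : (t₂ : ℝ) = 2 * Nat.clog 2 n₁ + 1 := by rw [ht₂]; push_cast; ring
    have h7 : (c₃ : ℝ) = 3 * c₂ + 15 := by rw [hc₃]; push_cast; ring
    rw [h6, h7]
    linarith
  obtain ⟨n₂, hlt₂, hle₂, φ₂, hφ₂, hcode₂⟩ := exists_code _ t₂ q hM₂ (Nat.le_add_left 1 _) hq0
  have hn₂n₂ : (n₂ : ℝ) * n₂ ≤ 77760 * c₃ ^ 2 * (Λ ^ 4 * y) := by
    have h1 : (n₂ : ℝ) ≤ 2 * (q * t₂) := by exact_mod_cast hle₂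
    calc (n₂ : ℝ) * n₂ ≤ 2 * (q * t₂) * (2 * (q * t₂)) := by gcongr
      _ = 4 * (q * q) * t₂ ^ 2 := by ring
      _ ≤ 4 * (19440 * (Λ ^ 2 * y)) * (c₃ * Λ) ^ 2 := by gcongr
      _ = _ := by ring
  refine ⟨q, n₁, n₂, φ₁, φ₂, hq0, hn₁0, by omega, hφ₁, hφ₂, hcode₁, hcode₂, ?_, ?_⟩
  · have h1 : (36 * W * (W + 1) * s r Δ : ℝ) ≤ (q : ℝ) ^ 2 := by
      rw [← hσs', sq]
      exact_mod_cast hnq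
    have hs1 : (0 : ℝ) < s r Δ := by rw [← hσs']; exact_mod_cast hσ1
    rw [div_div, div_le_div_iff₀ (by positivity) (by positivity)]
    linarith
  · have hΛ2 : Λ ^ 2 * y ≤ Λ ^ 4 * y :=
      mul_le_mul_of_nonneg_right (pow_le_pow_right₀ hΛ1 (by norm_num)) (by linarith)
    have hΛ4 : 1 ≤ Λ ^ 4 * y := by
      have := one_le_pow₀ (n := 4) hΛ1
      nlinarith
    have hΛC : Λ ^ 5 ≤ Λ ^ C := pow_le_pow_right₀ hΛ1 (by omega)
    calc ((2 * ((W + 1) * (2 * (n₂ * n₂) + q * q + 8)) : ℕ) : ℝ)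
        = 2 * ((W + 1) * (2 * (n₂ * n₂) + q * q + 8)) := by push_cast; ring
      _ ≤ 2 * (10 * Λ * (2 * (77760 * c₃ ^ 2 * (Λ ^ 4 * y)) + 19440 * (Λ ^ 4 * y)
          + 8 * (Λ ^ 4 * y))) := by
          have h1 := hqq.trans (mul_le_mul_of_nonneg_left hΛ2 (by norm_num))
          have h2 : (0 : ℝ) ≤ 2 * (n₂ * n₂) + q * q + 8 := by positivity
          refine mul_le_mul_of_nonneg_left ?_ (by norm_num)
          refine mul_le_mul hW' ?_ h2 (by linarith)
          linarith
      _ = C * (y * Λ ^ 5) := by rw [hC]; push_cast; ring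
      _ ≤ C * (y * Λ ^ C) := by gcongr

/-! ### From one stage of steps to the potentials S_i and S_{i+1}. -/

section Main

variable {V E : Type*} [Fintype V] [Fintype E] [DecidableEq V] [DecidableEq E]

theorem S_eq_stepPotential (H : MultiHypergraph V E) (a : E → ℝ) (r Δ i : ℕ) (p η : ℝ)
    (L : Finset E) :
    S H a r Δ i L = stepPotential H (w r Δ) p ((1 / (2 * α r Δ)) ^ (s r Δ - (i : ℤ))) (b r Δ i)
      (Ring.choose ((Δ : ℝ) * (2 : ℝ) ^ (-(i : ℤ))) (w r Δ)) η a 0 L := by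
  simp only [stepPotential, pow_zero, mul_one, one_mul]
  rfl

theorem b_pos {r Δ i : ℕ} (hr : 2 ≤ r) (hi : (i : ℤ) < s r Δ) : 0 < b r Δ i := by
  have hΔ := two_le_of_lt_s hi
  have hw := two_le_w hr hΔ
  have hα := one_le_α hi
  have hx : 0 < x r Δ := by
    rw [x]
    have : (0 : ℝ) < Δ := by positivity
    positivity
  have hβ : 0 < β r Δ := by rw [β]; positivity
  rw [b]
  positivity

/-- The factor 2^{w+1} makes up for the survival probability of a pair over a stage, and 1/α is the
slack for the errors. -/
theorem b_succ {r Δ i : ℕ} (hi : (i : ℤ) < s r Δ) :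
    b r Δ (i + 1) = b r Δ i * 2 ^ (w r Δ + 1) / α r Δ := by
  have hα := one_le_α hi
  have hα0 : α r Δ ≠ 0 := by positivity
  have h1 : (2 : ℝ) ^ (-((s r Δ - ((i + 1 : ℕ) : ℤ)) * ((w r Δ : ℤ) + 1)))
      = (2 : ℝ) ^ (-((s r Δ - (i : ℤ)) * ((w r Δ : ℤ) + 1))) * 2 ^ (w r Δ + 1) := by
    rw [← zpow_natCast, ← zpow_add₀ (by norm_num)]
    congr 1
    push_cast
    ring
  have h2 : α r Δ ^ (s r Δ - (i : ℤ)) = α r Δ ^ (s r Δ - ((i + 1 : ℕ) : ℤ)) * α r Δ := by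
    rw [← zpow_add_one₀ hα0]
    congr 1
    push_cast
    ring
  rw [b, b, h1, h2]
  field_simp

/-- After w + 1 steps p^{-j} equals 2. The weight term then needs only α ≥ 1. In the penalty,
binom(D/2, w) ≤ 2^{-w} binom(D, w) turns the factor 2^{w+1} of `b_succ` into 2, and 1/α ≤ (1 +
η)^{-(w+1)} covers the accumulated errors. -/
theorem stepPotential_le_S (H : MultiHypergraph V E) (a : E → ℝ) (ha : ∀ e, 0 ≤ a e)
    {r Δ i : ℕ} (hr : 2 ≤ r) (hi : (i : ℤ) < s r Δ) {p : ℝ} (hpw : p ^ (w r Δ + 1) = 1 / 2)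
    (L : Finset E) :
    stepPotential H (w r Δ) p ((1 / (2 * α r Δ)) ^ (s r Δ - (i : ℤ))) (b r Δ i)
      (Ring.choose ((Δ : ℝ) * (2 : ℝ) ^ (-(i : ℤ))) (w r Δ))
      (1 / (2 * s r Δ * ((w r Δ : ℝ) + 1))) a (w r Δ + 1) L ≤ S H a r Δ (i + 1) L := by
  have hΔ := two_le_of_lt_s hi
  have hα := one_le_α hi
  have hb := b_pos hr hi
  have hs1 : (1 : ℝ) ≤ s r Δ := by exact_mod_cast (by omega : (1 : ℤ) ≤ s r Δ)
  have hηα := one_add_pow_le_α hi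
  set η := 1 / (2 * s r Δ * ((w r Δ : ℝ) + 1)) with hη
  have hη0 : 0 ≤ η := by positivity
  set D := (Δ : ℝ) * (2 : ℝ) ^ (-(i : ℤ)) with hD
  have hp2 : p⁻¹ ^ (w r Δ + 1) = 2 := by rw [inv_pow, hpw]; norm_num
  have hD' : (Δ : ℝ) * (2 : ℝ) ^ (-((i + 1 : ℕ) : ℤ)) = D / 2 := by
    rw [hD, mul_div_assoc]
    congr 1
    rw [show -((i + 1 : ℕ) : ℤ) = -(i : ℤ) - 1 by push_cast; ring, zpow_sub_one₀ (by norm_num)]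
    rfl
  have hth := threshold_lt hr hi
  rw [← hD] at hth
  have hDw : 2 * (w r Δ : ℝ) ≤ D := by
    have hw : (2 : ℝ) ≤ w r Δ := by exact_mod_cast two_le_w hr hΔ
    have h1 : 1 ≤ Real.log ((r : ℝ) * Δ) ^ 10 := one_le_pow₀ (one_le_log hr hΔ)
    have h2 : (2 : ℝ) ^ 3 ≤ (w r Δ : ℝ) ^ 3 := by gcongr
    rw [threshold] at hth
    calc 2 * (w r Δ : ℝ) ≤ (w r Δ : ℝ) ^ 3 * w r Δ := by gcongr; linarith
      _ = (w r Δ : ℝ) ^ 4 * 1 := by ring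
      _ ≤ (w r Δ : ℝ) ^ 4 * Real.log ((r : ℝ) * Δ) ^ 10 := by gcongr
      _ ≤ D := hth.le
  have hD0 : 0 < D := by
    have : (2 : ℝ) ≤ w r Δ := by exact_mod_cast two_le_w hr hΔ
    linarith
  set Q := Ring.choose D (w r Δ)
  have hQ0 : 0 ≤ Q := ring_choose_nonneg (by linarith [(Nat.cast_nonneg (w r Δ) : (0 : ℝ) ≤ _)])
  have hQ : 2 ^ w r Δ * Ring.choose (D / 2) (w r Δ) ≤ Q := by
    have h := ring_choose_le (y := D) (y' := D / 2) (w := w r Δ) (by linarith) (by linarith) hD0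
    rw [show D / 2 / D = 2⁻¹ by field_simp, inv_pow] at h
    calc _ ≤ 2 ^ w r Δ * ((2 ^ w r Δ)⁻¹ * Q) := by gcongr
      _ = Q := by field_simp
  rw [S, stepPotential, hp2, b_succ hi, hD']
  apply sub_le_sub
  · have h1 : (1 / (2 * α r Δ)) ^ (s r Δ - (i : ℤ))
        = (1 / (2 * α r Δ)) ^ (s r Δ - ((i + 1 : ℕ) : ℤ)) * (1 / (2 * α r Δ)) := by
      rw [← zpow_add_one₀ (by positivity)]
      congr 1
      push_cast
      ring
    rw [h1]
    refine mul_le_mul_of_nonneg_right ?_ (sum_nonneg fun e _ => ha e)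
    rw [mul_assoc]
    refine mul_le_of_le_one_right (by positivity) ?_
    rw [one_div_mul_eq_div, div_le_one (by positivity)]
    linarith
  · have hinv : 1 / α r Δ ≤ (1 + η)⁻¹ ^ (w r Δ + 1) := by
      rw [inv_pow, ← one_div]
      exact one_div_le_one_div_of_le (by positivity) hηα
    have hB : b r Δ i * 2 ^ (w r Δ + 1) / α r Δ
        = b r Δ i * 2 ^ (w r Δ + 1) * (1 / α r Δ) := by ring
    rw [hB, mul_sum, mul_sum]
    refine sum_le_sum fun v _ => ?_
    have hu : 0 ≤ ∑ e ∈ star H L v, a e := sum_nonneg fun e _ => ha e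
    have hQ' : 0 ≤ Ring.choose (D / 2) (w r Δ) := ring_choose_nonneg (by linarith)
    have hdeg : (H.degOn L v) = (star H L v).card := rfl
    have hwt : H.weightOn a L v = ∑ e ∈ star H L v, a e := rfl
    rw [hdeg, hwt]
    calc b r Δ i * 2 ^ (w r Δ + 1) * (1 / α r Δ)
          * ((Ring.choose (D / 2) (w r Δ) + (star H L v).card.choose (w r Δ))
            * ∑ e ∈ star H L v, a e)
        ≤ b r Δ i * 2 ^ (w r Δ + 1) * (1 + η)⁻¹ ^ (w r Δ + 1)
          * ((Ring.choose (D / 2) (w r Δ) + (star H L v).card.choose (w r Δ))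
            * ∑ e ∈ star H L v, a e) := by gcongr
      _ = b r Δ i * (1 + η)⁻¹ ^ (w r Δ + 1)
          * ((2 * (2 ^ w r Δ * Ring.choose (D / 2) (w r Δ))
            + 2 ^ (w r Δ + 1) * (star H L v).card.choose (w r Δ))
            * ∑ e ∈ star H L v, a e) := by ring
      _ ≤ _ := by gcongr

theorem color_ne_of_isGoodColoring {H : MultiHypergraph V E} {K r Δ : ℕ} {c : V ⊕ E → ℕ}
    (hc : IsGoodColoring H K r Δ c) (f g : E) (hfg : f ≠ g)
    (h : ∃ v, v ∈ H.verts f ∧ v ∈ H.verts g) : c (Sum.inr f) ≠ c (Sum.inr g) := by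
  obtain ⟨v, hf, hg⟩ := h
  have h1 := ((H.incGraph_adj_inl_inr v f).2 hf).symm
  have h2 := (H.incGraph_adj_inl_inr v g).2 hg
  exact hc.1 _ _ ⟨fun h => hfg (Sum.inr_injective h),
    SimpleGraph.Walk.cons h1 (SimpleGraph.Walk.cons h2 SimpleGraph.Walk.nil), by simp⟩

/-- The label of a hyperedge before the first round. -/
def startLabel (id : ℕ) : NodeInput → Label
  | NodeInput.vertex k => ⟨id, k, 0, false, 0, 0, 0, 0⟩
  | NodeInput.edge k u b => ⟨id, k, u, b, 0, 0, 0, 0⟩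

end Main

end LocalRounding

open LocalRounding in
theorem mainTheorem10 (K : ℕ) :
    ∃ C : ℕ, ∀ (r Δ i : ℕ), 2 ≤ r → (i : ℤ) < Rounding.s r Δ →
      ∃ (A : LocalAlgorithm NodeInput Bool) (T : ℕ),
        (T : ℝ) ≤ C * (((r : ℝ) + Real.log Δ) * (1 + Real.log ((r : ℝ) + Real.log Δ)) ^ C) ∧
        ∀ (V : Type*) (E : Type*) [Fintype V] [Fintype E] [DecidableEq V] [DecidableEq E]
          (H : MultiHypergraph V E),
          (∀ v, H.degOn Finset.univ v ≤ Δ) →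
          (∀ e, (H.verts e).card ≤ r) →
          ∀ (a : E → ℝ), (∀ e, 0 ≤ a e) →
          ∀ (c : V ⊕ E → ℕ), IsGoodColoring H K r Δ c →
          ∀ (ident : V ⊕ E → ℕ), Function.Injective ident →
          ∀ (Ei : Finset E),
            (∀ v, (H.degOn Ei v : ℝ) ≤ (Δ : ℝ) * (2 : ℝ) ^ (4 - (i : ℤ))) →
            selectedEdges A H ident c a Ei T ⊆ Ei ∧
            Rounding.S H a r Δ i Ei ≤
              Rounding.S H a r Δ (i + 1) (selectedEdges A H ident c a Ei T) := by
  obtain ⟨C, hC⟩ := exists_parameters K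
  refine ⟨C, fun r Δ i hr hi => ?_⟩
  obtain ⟨q, n₁, n₂, φ₁, φ₂, hq, hn₁, hn₂, hφ₁, hφ₂, hcode₁, hcode₂, hqη, hT⟩ := hC r Δ i hr hi
  have hw := two_le_w hr (two_le_of_lt_s hi)
  have hs1 : (1 : ℝ) ≤ Rounding.s r Δ := by
    exact_mod_cast (by omega : (1 : ℤ) ≤ Rounding.s r Δ)
  set p : ℝ := (2 : ℝ) ^ (-(1 / ((Rounding.w r Δ + 1 : ℕ) : ℝ))) with hp
  have hp0 : 0 < p := by positivity
  have hpw : p ^ (Rounding.w r Δ + 1) = 1 / 2 := by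
    rw [hp, ← Real.rpow_natCast, ← Real.rpow_mul (by norm_num), neg_mul,
      one_div_mul_cancel (by positivity), Real.rpow_neg_one, one_div]
  set η := 1 / (2 * Rounding.s r Δ * ((Rounding.w r Δ : ℝ) + 1)) with hη
  set Q := Ring.choose ((Δ : ℝ) * (2 : ℝ) ^ (-(i : ℤ))) (Rounding.w r Δ) with hQ
  set B := (1 / (2 * Rounding.α r Δ)) ^ (Rounding.s r Δ - (i : ℤ)) with hB
  set rules := roundingRules (Rounding.w r Δ) q n₁ n₂ φ₁ φ₂ p B (Rounding.b r Δ i) Q η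
    (Rounding.w r Δ + 1) with hrules
  have hQ0 : 0 ≤ Q := by
    refine ring_choose_nonneg ?_
    have h1 := threshold_lt hr hi
    have h2 : 1 ≤ Real.log ((r : ℝ) * Δ) ^ 10 :=
      one_le_pow₀ (one_le_log hr (two_le_of_lt_s hi))
    have h3 : (1 : ℝ) ≤ Rounding.w r Δ := by exact_mod_cast (by omega : 1 ≤ Rounding.w r Δ)
    have h4 : (Rounding.w r Δ : ℝ) ≤ (Rounding.w r Δ : ℝ) ^ 4 := le_self_pow₀ h3 (by norm_num)
    rw [threshold] at h1
    nlinarith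
  refine ⟨ruleAlgorithm startLabel rules Label.active, 2 * rules.length, ?_, ?_⟩
  · rw [hrules, length_roundingRules]
    exact hT
  · intro V E _ _ _ _ H _ _ a ha c hc ident hid Ei _
    set l₀ : E → Label := fun e => startLabel (ident (Sum.inr e)) (nodeInput c a Ei (Sum.inr e))
    have hl₀ : Consistent ident c a Ei l₀ :=
      ⟨fun e => rfl, fun e => rfl, fun e => rfl, fun e => decide_eq_true_iff⟩
    obtain ⟨L', hL', hc', -, hpot⟩ := runRules_roundingRules hl₀ hid ha (by omega) hn₁ hn₂ hq
      φ₁ φ₂ hφ₁ hφ₂ hcode₁ hcode₂ (fun e => hc.2 _) (color_ne_of_isGoodColoring hc)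
      (fun e => rfl) hp0 hpw B (b_pos hr hi).le hQ0 (by positivity) hqη
      (choose_pred_small hr hi) (Rounding.w r Δ + 1) le_rfl rfl
    have hsel : selectedEdges (ruleAlgorithm startLabel rules Label.active) H ident c a Ei
        (2 * rules.length) = L' := by
      ext e
      rw [selectedEdges, Finset.mem_filter, ruleAlgorithm_result, hc'.active_iff]
      simp
    rw [hsel]
    refine ⟨hL', ?_⟩
    rw [S_eq_stepPotential H a r Δ i p η]
    exact hpot.trans (stepPotential_le_S H a ha hr hi hpw L')
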